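/- Let $N\ge 3$ be an integer, $\zeta_N=e^{2\pi i/N}$, $\sigma=\begin{pmatrix}0&-1\\1&0\end{pmatrix}$, and let $B_k$ denote the $k$-th Bernoulli polynomial and $\{x\}$ the fractional part of $x$. Let $$E(N)(\mathbb C)=(\mathbb Z^2\rtimes \mathrm{SL}_2(\mathbb Z))\backslash(\mathcal H\times\mathbb C\times \mathrm{GL}_2(\mathbb Z/N\mathbb Z)),\qquad Y(N)(\mathbb C)=\mathrm{SL}_2(\mathbb Z)\backslash(\mathcal H\times \mathrm{GL}_2(\mathbb Z/N\mathbb Z)),$$ where $\binom{m}{n}$ acts by $(\tau,z,h)\mapsto(\tau,z+m-n\tau,h)$ and $\gamma=\begin{pmatrix}a&b\\c&d\end{pmatrix}$ by $(\tau,z,h)\mapsto(\gamma\tau,\frac{z}{c\tau+d},\gamma h)$, and let $p:E(N)\to Y(N)$ be the projection. For $m,n\in\mathbb Z$ the Shokurov cycle is $$(mX+nY)\{0,\infty\}=\{[\tau,t(m\tau+n),\sigma] : \tau=iy,\ y>0,\ t\in[0,1]\}\subset E(N)(\mathbb C).$$ The integral of a $2$-form $\omega$ over it is said to converge absolutely if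 the function $f(y,t)$ on $(0,\infty)\times[0,1]$, defined by pulling $\omega$ back to $f(y,t)\,dy\wedge dt$ along this parametrisation, is Lebesgue integrable. For $u=(a,b)\in(\mathbb Z/N\mathbb Z)^2\setminus\{(0,0)\}$, with $0\le\tilde a<N$ the representative of $a$ and $q^\alpha=e^{2\pi i\alpha\tau}$, let $$g_u(\tau)=q^{\frac12B_2(\tilde a/N)}\prod_{n\ge0}(1-q^{n+\tilde a/N}\zeta_N^b)\prod_{n\ge1}(1-q^{n-\tilde a/N}\zeta_N^{-b})$$ be the Siegel unit. For $v=(v_1,v_2)\in(\mathbb Z/N\mathbb Z)^2$ put $e_v(m,n)=\zeta_N^{v_1n-v_2m}$. The realisations of the Eisenstein symbols are the following forms on $Y(N)(\mathbb C)$ and $E(N)(\mathbb C)$, written on the sheet $h=\sigma$ (on a general sheet $h$ replace $u,v$ by $uh^{T}\sigma$, $vh^{T}\sigma$), with $y=\mathrm{Im}\,\tau$ and $Dz=dz-\frac{\mathrm{Im}\,z}{\mathrm{Im}\,\tau}\,d\tau$: $$\mathrm{Eis}^0_{\mathcal D}(u)=\tfrac2N\log|g_u|,\qquad \mathrm{Eis}^0_{\mathrm{hol}}(u)=\tfrac2N\,\mathrm{dlog}\,g_u,$$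 $$\mathrm{Eis}^1_{\mathcal D}(v)=\frac{3y}{2\pi N}\sum_{(m,n)\neq(0,0)}e_v(m,n)\left(\frac{Dz}{(m\tau+n)^2(m\bar\tau+n)}+\frac{\overline{Dz}}{(m\tau+n)(m\bar\tau+n)^2}\right),$$ $$\mathrm{Eis}^1_{\mathrm{hol}}(v)=\frac{3}{\pi iN}\sum_{(m,n)\ne(0,0)}\frac{e_v(m,n)}{(m\tau+n)^3}\,d\tau\wedge dz .$$ With $\pi_k(\alpha)=\frac12(\alpha+(-1)^k\overline\alpha)$, the Deninger--Scholl form splits as $\mathrm{Eis}^{0,1}_{\mathcal D}(u,v)=\eta^1_{u,v}+\eta^2_{u,v}$, where $$\eta^1_{u,v}=p^*\mathrm{Eis}^0_{\mathcal D}(u)\cdot\pi_2(\mathrm{Eis}^1_{\mathrm{hol}}(v)),\qquad \eta^2_{u,v}=-p^*\pi_1(\mathrm{Eis}^0_{\mathrm{hol}}(u))\wedge\mathrm{Eis}^1_{\mathcal D}(v).$$ For $\phi:(\mathbb Z/N\mathbb Z)^2\times(\mathbb Z/N\mathbb Z)^2\to\mathbb C$ with $\phi((0,0),v)=0$ for all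 $v$, let $\eta^1_\phi=\sum_{u,v}\phi(u,v)\eta^1_{u,v}$, and for $g\in\mathrm{GL}_2(\mathbb Z/N\mathbb Z)$ let $(\phi|g)(u,v)=\phi(ug^{-1},vg^{-1})$. Consider the two conditions $$\text{(C1)}\quad\sum_{u,v}\phi(u,v)B_2(\{u_1/N\})B_3(\{v_1/N\})=0,$$ $$\text{(C2)}\quad\sum_{\substack{u,v\\ u_1=0}}\phi(u,v)\log|1-\zeta_N^{u_2}|\,B_3(\{v_1/N\})=0,$$ where in (C2) the terms with $u=(0,0)$ are zero because $\phi((0,0),v)=0$. **Proposition.** 1. For all $u,v\in(\mathbb Z/N\mathbb Z)^2$ with $u\ne(0,0)$ and all integers $m,n$, the integral $\int_{(mX+nY)\{0,\infty\}}\eta^2_{u,v}$ converges absolutely. 2. If $\phi$ (with $\phi((0,0),v)=0$ for all $v$) satisfies (C1) and (C2), then $\int_{X\{0,\infty\}}\eta^1_\phi$ converges absolutely. 3. If $\phi$ (with $\phi((0,0),v)=0$ for all $v$) is such that $\phi|\sigma$ satisfies (C1) and (C2), then $\int_{Y\{0,\infty\}}\eta^1_\phi$ converges absolutely. -/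

import Mathlib

open MeasureTheory

noncomputable section

namespace EisensteinSymbol

/-! ### Differential forms

The complex points of the universal elliptic curve are
`E(N)(ℂ) = (ℤ² ⋊ SL₂(ℤ)) \ (ℋ × ℂ × GL₂(ℤ/N))` and those of the modular curve are
`Y(N)(ℂ) = SL₂(ℤ) \ (ℋ × GL₂(ℤ/N))`.  The group acts by `(τ, z, h) ↦ (τ, z + m - nτ, h)` and
`(τ, z, h) ↦ (γτ, z / (cτ + d), γh)`, freely and properly discontinuously for `N ≥ 3`.
A differential form on either of them is described by its pull-back to the covering, that is, for
every `h`, by a form in the coordinates `(τ, z)` (resp. `τ`) on the domain `Im τ > 0`;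
the values at `Im τ ≤ 0` play no role. -/

/-- Complex-valued real-alternating `k`-forms on a real vector space. -/
abbrev Alt (V : Type) [NormedAddCommGroup V] [NormedSpace ℝ V] (k : ℕ) : Type :=
  V [⋀^Fin k]→L[ℝ] ℂ

/-- Differential `k`-forms on `Y(N)(ℂ)`, in the coordinate `τ` on each sheet `h`. -/
abbrev FormY (N k : ℕ) : Type := GL (Fin 2) (ZMod N) → ℂ → Alt ℂ k

/-- Differential `k`-forms on `E(N)(ℂ)`, in the coordinates `(τ, z)` on each sheet `h`. -/
abbrev FormE (N k : ℕ) : Type := GL (Fin 2) (ZMod N) → ℂ × ℂ → Alt (ℂ × ℂ) k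

/-- Pull-back of forms along the projection `p : E(N) → Y(N)`, `(τ, z, h) ↦ (τ, h)`. -/
def pullE {N k : ℕ} (α : FormY N k) : FormE N k := fun h x =>
  (α h x.1).compContinuousLinearMap (ContinuousLinearMap.fst ℝ ℂ ℂ)

section Alt

variable {V : Type} [NormedAddCommGroup V] [NormedSpace ℝ V]

/-- A real-linear functional, as a `1`-form. -/
def oneForm (l : V →L[ℝ] ℂ) : Alt V 1 :=
  ContinuousAlternatingMap.ofSubsingleton ℝ V ℂ (0 : Fin 1) l

/-- A `1`-form, as a real-linear functional. -/
def toFunctional (α : Alt V 1) : V →L[ℝ] ℂ :=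
  (ContinuousAlternatingMap.ofSubsingleton ℝ V ℂ (0 : Fin 1)).symm α

/-- The wedge product of two `1`-forms: `(α ∧ β)(x, y) = α(x) β(y) - α(y) β(x)`. -/
def wedge (α β : Alt V 1) : Alt V 2 :=
  ContinuousMultilinearMap.alternatization
    ((ContinuousMultilinearMap.mkPiAlgebra ℝ (Fin 2) ℂ).compContinuousLinearMap
      ![toFunctional α, toFunctional β])

theorem wedge_apply (α β : Alt V 1) (x y : V) :
    wedge α β ![x, y] = α ![x] * β ![y] - α ![y] * β ![x] := by
  have hx : ∀ (γ : Alt V 1) (x : V), toFunctional γ x = γ ![x] := by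
    intro γ x
    change γ (fun _ => x) = γ ![x]
    congr 1; ext i; fin_cases i; rfl
  rw [wedge, ContinuousMultilinearMap.alternatization_apply_apply]
  have h2 : (Finset.univ : Finset (Equiv.Perm (Fin 2))) = {1, Equiv.swap 0 1} := by decide
  rw [h2, Finset.sum_pair (by decide)]
  simp [Fin.prod_univ_two, hx]
  ring

/-- The complex conjugate of a form. -/
def conjForm {k : ℕ} (α : Alt V k) : Alt V k :=
  (Complex.conjCLE : ℂ →L[ℝ] ℂ).compContinuousAlternatingMap α

/-- The projection `π_n(α) = (α + (-1)^n ᾱ) / 2` onto forms with values in `ℝ(n) = (2πi)^n ℝ`. -/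
def piProj {k : ℕ} (n : ℕ) (α : Alt V k) : Alt V k :=
  (1 / 2 : ℂ) • (α + (-1 : ℂ) ^ n • conjForm α)

end Alt

/-- The `1`-form `dτ` on the upper half-plane. -/
def dτY : Alt ℂ 1 := oneForm (ContinuousLinearMap.id ℝ ℂ)

/-- The `1`-form `dτ` in the coordinates `(τ, z)`. -/
def dτ : Alt (ℂ × ℂ) 1 := oneForm (ContinuousLinearMap.fst ℝ ℂ ℂ)

/-- The `1`-form `dz` in the coordinates `(τ, z)`. -/
def dz : Alt (ℂ × ℂ) 1 := oneForm (ContinuousLinearMap.snd ℝ ℂ ℂ)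

/-- The translation-covariant `1`-form `dz - (Im z / Im τ) dτ`. If `z = sτ + r` with `s, r` real,
it equals `τ ds + dr`. -/
def Dz (x : ℂ × ℂ) : Alt (ℂ × ℂ) 1 := dz - ((x.2.im / x.1.im : ℝ) : ℂ) • dτ

/-! ### Siegel units and Eisenstein series -/

/-- `B_k({x / N})` for `x ∈ ℤ/N`, with `B_k` the `k`-th Bernoulli polynomial. -/
def bernFract {N : ℕ} (k : ℕ) (x : ZMod N) : ℝ :=
  Polynomial.aeval ((x.val : ℝ) / N) (Polynomial.bernoulli k)

/-- `ζ_N^b = exp(2πi b / N)`. -/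
def zetaPow {N : ℕ} [NeZero N] (b : ZMod N) : ℂ := ZMod.stdAddChar b

/-- `q^α = exp(2πi α τ)`. -/
def qPow (α : ℝ) (τ : ℂ) : ℂ := Complex.exp (2 * Real.pi * Complex.I * α * τ)

/-- The Siegel unit `g_{a,b}(τ)`, `u = (a, b) ≠ (0, 0)`. -/
def siegelUnit {N : ℕ} [NeZero N] (u : Fin 2 → ZMod N) (τ : ℂ) : ℂ :=
  qPow (bernFract 2 (u 0) / 2) τ *
    (∏' n : ℕ, (1 - qPow ((n : ℝ) + ((u 0).val : ℝ) / N) τ * zetaPow (u 1))) *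
    (∏' n : ℕ, (1 - qPow (((n : ℝ) + 1) - ((u 0).val : ℝ) / N) τ * zetaPow (-(u 1))))

/-- For `v = (v₁, v₂)`, the Eisenstein series
`∑_{(m,n) ≠ (0,0)} exp(2πi (v₁ n - v₂ m) / N) / ((mτ + n)^a (m τ̄ + n)^b)`
(absolutely convergent for `a + b ≥ 3` and `Im τ > 0`). -/
def eisSeries {N : ℕ} [NeZero N] (a b : ℕ) (v : Fin 2 → ZMod N) (τ : ℂ) : ℂ :=
  ∑' p : {p : ℤ × ℤ // p ≠ 0},
    zetaPow (v 0 * (p.1.2 : ZMod N) - v 1 * (p.1.1 : ZMod N)) /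
      (((p.1.1 : ℂ) * τ + p.1.2) ^ a * ((p.1.1 : ℂ) * (starRingEnd ℂ) τ + p.1.2) ^ b)

/-! ### Realisations of the Eisenstein symbols -/

/-- The matrix `σ = (0, -1; 1, 0)` in `GL₂(ℤ/N)`. -/
def sigma (N : ℕ) : GL (Fin 2) (ZMod N) where
  val := !![0, -1; 1, 0]
  inv := !![0, 1; -1, 0]
  val_inv := by simp [Matrix.one_fin_two]
  inv_val := by simp [Matrix.one_fin_two]

/-- `GL₂(ℤ/N)` acts on `E(N)` by `g · (τ, z, h) = (τ, z, h gᵀ)`, and Eisenstein symbols satisfy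
`g^* Eis(u) = Eis(u g)`.  On the sheet `h = σ gᵀ`, i.e. `g = hᵀ σ`, the symbol of `u` is therefore
given by the same formula as the symbol of `u g = u hᵀ σ` on the sheet `σ`.
This is the vector `u hᵀ σ`. -/
def onSheet {N : ℕ} (h : GL (Fin 2) (ZMod N)) (u : Fin 2 → ZMod N) : Fin 2 → ZMod N :=
  Matrix.vecMul u ((h : Matrix (Fin 2) (Fin 2) (ZMod N)).transpose *
    (sigma N : Matrix (Fin 2) (Fin 2) (ZMod N)))

/-- On the sheet `σ`, the symbol of `u` is given by the vector `u` itself. -/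
theorem onSheet_sigma {N : ℕ} (u : Fin 2 → ZMod N) : onSheet (sigma N) u = u := by
  have : ((sigma N : Matrix (Fin 2) (Fin 2) (ZMod N)).transpose *
    (sigma N : Matrix (Fin 2) (Fin 2) (ZMod N))) = 1 := by
    ext i j; fin_cases i <;> fin_cases j <;> simp [sigma, Matrix.mul_apply]
  rw [onSheet, this, Matrix.vecMul_one]

variable {N : ℕ} [NeZero N]

/-- The function `Eis⁰_𝒟(u) = (2/N) log |g_u|` on `Y(N)(ℂ)`. -/
def Eis0D (u : Fin 2 → ZMod N) (h : GL (Fin 2) (ZMod N)) (τ : ℂ) : ℝ :=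
  2 / N * Real.log ‖siegelUnit (onSheet h u) τ‖

/-- The holomorphic `1`-form `Eis⁰_hol(u) = (2/N) dlog g_u` on `Y(N)(ℂ)`. -/
def Eis0hol (u : Fin 2 → ZMod N) : FormY N 1 := fun h τ =>
  (2 / N * logDeriv (siegelUnit (onSheet h u)) τ : ℂ) • dτY

/-- The imaginary-valued real analytic `1`-form `Eis¹_𝒟(v)` on `E(N)(ℂ)`: on the sheet `σ`, with
`y = Im τ`, it is
`(3y / 2πN) ∑_{(m,n) ≠ 0} e^{2πi(v₁n - v₂m)/N} (Dz / ((mτ+n)²(mτ̄+n)) + conj(Dz) / ((mτ+n)(mτ̄+n)²))`.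
It satisfies `d Eis¹_𝒟(v) = π₁(Eis¹_hol(v))`. -/
def Eis1D (v : Fin 2 → ZMod N) : FormE N 1 := fun h x =>
  ((3 * x.1.im / (2 * Real.pi * N) : ℝ) : ℂ) •
    (eisSeries 2 1 (onSheet h v) x.1 • Dz x + eisSeries 1 2 (onSheet h v) x.1 • conjForm (Dz x))

/-- The holomorphic `2`-form `Eis¹_hol(v)` on `E(N)(ℂ)`, a holomorphic Eisenstein series of weight
`3`: on the sheet `σ` it is
`(3 / πiN) ∑_{(m,n) ≠ 0} e^{2πi(v₁n - v₂m)/N} (mτ+n)⁻³ dτ ∧ dz`. -/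
def Eis1hol (v : Fin 2 → ZMod N) : FormE N 2 := fun h x =>
  (3 / (Real.pi * Complex.I * N) * eisSeries 3 0 (onSheet h v) x.1 : ℂ) • wedge dτ dz

/-- `η¹_{u,v} = p^* Eis⁰_𝒟(u) · π₂(Eis¹_hol(v))`. -/
def eta1 (u v : Fin 2 → ZMod N) : FormE N 2 := fun h x =>
  (Eis0D u h x.1 : ℂ) • piProj 2 (Eis1hol v h x)

/-- `η²_{u,v} = - p^* π₁(Eis⁰_hol(u)) ∧ Eis¹_𝒟(v)`. -/
def eta2 (u v : Fin 2 → ZMod N) : FormE N 2 := fun h x =>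
  -wedge (pullE (fun h τ => piProj 1 (Eis0hol u h τ)) h x) (Eis1D v h x)

/-- `η¹_φ = ∑_{u,v} φ(u,v) η¹_{u,v}`, for `φ` with `φ((0,0), v) = 0` for all `v`. -/
def eta1Lin (φ : (Fin 2 → ZMod N) → (Fin 2 → ZMod N) → ℂ) : FormE N 2 := fun h x =>
  ∑ u, ∑ v, φ u v • eta1 u v h x

/-- The right action `(φ|g)(u, v) = φ(u g⁻¹, v g⁻¹)` of `GL₂(ℤ/N)`. -/
def slash (φ : (Fin 2 → ZMod N) → (Fin 2 → ZMod N) → ℂ) (g : GL (Fin 2) (ZMod N)) :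
    (Fin 2 → ZMod N) → (Fin 2 → ZMod N) → ℂ := fun u v =>
  φ (Matrix.vecMul u (g⁻¹ : GL (Fin 2) (ZMod N)).val)
    (Matrix.vecMul v (g⁻¹ : GL (Fin 2) (ZMod N)).val)

/-- `∑_{u,v} φ(u,v) B₂({u₁/N}) B₃({v₁/N}) = 0`. -/
def Cond1 (φ : (Fin 2 → ZMod N) → (Fin 2 → ZMod N) → ℂ) : Prop :=
  ∑ u, ∑ v, φ u v * (bernFract 2 (u 0) : ℂ) * (bernFract 3 (v 0) : ℂ) = 0

/-- `∑_{u,v, u₁ = 0} φ(u,v) log|1 - ζ_N^{u₂}| B₃({v₁/N}) = 0`. -/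
def Cond2 (φ : (Fin 2 → ZMod N) → (Fin 2 → ZMod N) → ℂ) : Prop :=
  ∑ u with u 0 = 0, ∑ v,
    φ u v * (Real.log ‖1 - zetaPow (u 1)‖ : ℂ) * (bernFract 3 (v 0) : ℂ) = 0

/-! ### Shokurov cycles -/

/-- The parametrisation `(y, t) ↦ (τ, t(mτ + n))`, `τ = iy`, of the Shokurov cycle
`(mX+nY){0,∞} = {[τ, t(mτ+n), σ] : τ ∈ {0,∞}, t ∈ [0,1]}`, where `{0,∞}` is the geodesic
`{iy : y > 0}`; it is the component in `ℋ × ℂ`, the third component being constantly `σ`. -/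
def shokurovParam (m n : ℤ) (p : ℝ × ℝ) : ℂ × ℂ :=
  (Complex.I * p.1, p.2 * (m * (Complex.I * p.1) + n))

/-- The function `f(y, t)` such that the `2`-form `ω` pulls back to `f(y, t) dy ∧ dt` under the
parametrisation of `(mX+nY){0,∞}`. -/
def shokurovDensity (m n : ℤ) (ω : FormE N 2) (p : ℝ × ℝ) : ℂ :=
  (ω (sigma N) (shokurovParam m n p)).compContinuousLinearMap
    (fderiv ℝ (shokurovParam m n) p) ![(1, 0), (0, 1)]

/-- Absolute convergence of the integral of the `2`-form `ω` over `(mX+nY){0,∞}`. -/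
def ConvergesAbsolutely (m n : ℤ) (ω : FormE N 2) : Prop :=
  IntegrableOn (shokurovDensity m n ω) (Set.Ioi (0 : ℝ) ×ˢ Set.Icc (0 : ℝ) 1) volume

end EisensteinSymbol

end

/-! Every density pulled back to the parameter domain depends on `y` alone, so the problem is
integrability on `(0, ∞)`: exponential decay at the cusp `i∞`, and boundedness at the cusp `0`,
which `τ ↦ -1/τ` exchanges with `i∞`.

Up to errors `O(e^{-2πy/N})` as `y → ∞`, `log|g_u(iy)|` equals `-π B₂({u₁/N}) y` plus the constant
`log|1 - ζ^{u₂}|` (only if `u₁ = 0`), and the weight 3 series `E_v(iy)` equals the purely imaginary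
constant `i (4π³/3) B₃({v₁/N})`. Up to constants, the density of `η¹` is `y log|g_u| Im E_v` along
`X{0,∞}` and `log|g_u| Re E_v` along `Y{0,∞}`. The second decays at `i∞` unconditionally; the main
term of the first is `y` times a linear polynomial whose two coefficients vanish by (C1) and (C2).
Since `E_v(i/y) = -i y³ E_{vσ}(iy)`, inversion swaps real and imaginary parts and replaces `φ` by
`φ|σ`. So `X` needs the conditions only at `i∞`, and `Y` only at `0`, for `φ|σ`.

For `η²` the density contains `Re (g_u'/g_u)`. The leading term of the logarithmic derivative is
imaginary, so the real part is exponentially small at both cusps and beats the polynomial growth of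
the Eisenstein factor.

The main inputs are `siegelUnit_S` (obtained by writing `g_u` as a theta function over `η` with
`jacobiTheta₂_eq_tprod`), `log_norm_siegelUnit_isBigO`, `re_logDeriv_siegelUnit_isBigO`,
`eisSeries_inv` and `eisSeries_isBigO`. -/

namespace EisensteinSymbol

open Filter Topology Complex Asymptotics

section

/-! ### The Jacobi triple product -/

/-- The `q`-Pochhammer symbol `∏_{i=1}^n (1 - q^i)`. -/
noncomputable def qPoch (q : ℂ) (n : ℕ) : ℂ := ∏ i ∈ Finset.range n, (1 - q ^ (i + 1))

/-- The Gaussian binomial coefficient. -/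
noncomputable def gaussBinom (q : ℂ) (m j : ℕ) : ℂ :=
  if j ≤ m then qPoch q m / (qPoch q j * qPoch q (m - j)) else 0

theorem qPoch_succ (q : ℂ) (n : ℕ) : qPoch q (n + 1) = qPoch q n * (1 - q ^ (n + 1)) :=
  Finset.prod_range_succ _ _

theorem one_sub_pow_ne_zero {q : ℂ} (hq : ‖q‖ < 1) (n : ℕ) : 1 - q ^ (n + 1) ≠ 0 := by
  rw [sub_ne_zero]
  intro h
  have := congrArg norm h
  rw [norm_one, norm_pow] at this
  exact (pow_lt_one₀ (norm_nonneg q) hq n.succ_ne_zero).ne' this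

theorem qPoch_ne_zero {q : ℂ} (hq : ‖q‖ < 1) (n : ℕ) : qPoch q n ≠ 0 :=
  Finset.prod_ne_zero_iff.mpr fun i _ => one_sub_pow_ne_zero hq i

/-- Of the two `q`-Pascal rules, this one fits splitting off the last factor of a product. After
clearing denominators it reads `1 - q^(m+1) = (1 - q^(m-j)) + q^(m-j) (1 - q^(j+1))`. -/
theorem gaussBinom_succ {q : ℂ} (hq : ‖q‖ < 1) (m j : ℕ) (hj : j ≤ m) :
    gaussBinom q (m + 1) (j + 1) =
      gaussBinom q m (j + 1) + q ^ (m - j) * gaussBinom q m j := by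
  obtain ⟨d, rfl⟩ := Nat.exists_eq_add_of_le hj
  have h1 := qPoch_ne_zero hq j
  have h3 := one_sub_pow_ne_zero hq j
  have h4 := one_sub_pow_ne_zero hq d
  rcases d with _ | d
  · have h6 := qPoch_ne_zero hq (j + 1)
    have h7 : qPoch q 0 = 1 := by simp [qPoch]
    simp [gaussBinom, h1, h6, h7]
  · have h2 := qPoch_ne_zero hq d
    have h5 := one_sub_pow_ne_zero hq d
    have e1 : j + (d + 1) + 1 - (j + 1) = d + 1 := by omega
    have e2 : j + (d + 1) - (j + 1) = d := by omega
    have e3 : j + (d + 1) - j = d + 1 := by omega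
    simp only [gaussBinom, if_pos (show j + 1 ≤ j + (d + 1) + 1 by omega),
      if_pos (show j + 1 ≤ j + (d + 1) by omega), if_pos (show j ≤ j + (d + 1) by omega),
      e1, e2, e3, qPoch_succ q (j + (d + 1)), qPoch_succ q j, qPoch_succ q d]
    field_simp
    ring

/-- The `q`-binomial theorem, with `q = p ^ 2`. -/
theorem prod_one_add_mul_pow {p : ℂ} (hp : ‖p ^ 2‖ < 1) (y : ℂ) (m : ℕ) :
    ∏ k ∈ Finset.range m, (1 + y * (p ^ 2) ^ k) =
      ∑ j ∈ Finset.range (m + 1), gaussBinom (p ^ 2) m j * p ^ (j * (j - 1)) * y ^ j := by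
  induction m with
  | zero => simp [gaussBinom, qPoch]
  | succ m ih =>
    rw [Finset.prod_range_succ, ih, Finset.sum_range_succ' _ (m + 1)]
    have h0 : ∀ m, gaussBinom (p ^ 2) m 0 = 1 := fun m => by
      have h7 : qPoch (p ^ 2) 0 = 1 := by simp [qPoch]
      simp [gaussBinom, qPoch_ne_zero hp, h7]
    have hlast : gaussBinom (p ^ 2) m (m + 1) = 0 := by simp [gaussBinom]
    have key : ∀ j ∈ Finset.range (m + 1),
        gaussBinom (p ^ 2) (m + 1) (j + 1) * p ^ ((j + 1) * (j + 1 - 1)) * y ^ (j + 1) =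
        gaussBinom (p ^ 2) m (j + 1) * p ^ ((j + 1) * (j + 1 - 1)) * y ^ (j + 1) +
        (gaussBinom (p ^ 2) m j * p ^ (j * (j - 1)) * y ^ j) * (y * (p ^ 2) ^ m) := by
      intro j hj
      have hj' : j ≤ m := by simpa [Nat.lt_succ_iff] using hj
      rw [gaussBinom_succ hp m j hj']
      have : (p ^ 2) ^ (m - j) * p ^ ((j + 1) * (j + 1 - 1)) =
          p ^ (j * (j - 1)) * (p ^ 2) ^ m := by
        rw [← pow_mul, ← pow_mul, ← pow_add, ← pow_add]
        congr 1
        obtain ⟨d, rfl⟩ := Nat.exists_eq_add_of_le hj'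
        rcases j with _ | j
        · simp
        · simp; ring
      linear_combination gaussBinom (p ^ 2) m j * y ^ (j + 1) * this
    rw [Finset.sum_congr rfl key, Finset.sum_add_distrib, ← Finset.sum_mul]
    have hs : ∑ j ∈ Finset.range (m + 1),
        gaussBinom (p ^ 2) m (j + 1) * p ^ ((j + 1) * (j + 1 - 1)) * y ^ (j + 1) + 1 =
        ∑ j ∈ Finset.range (m + 1), gaussBinom (p ^ 2) m j * p ^ (j * (j - 1)) * y ^ j := by
      rw [Finset.sum_range_succ, hlast, Finset.sum_range_succ' _ m, h0]
      simp
    rw [h0]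
    simp only [zero_mul, pow_zero, mul_one] at hs ⊢
    linear_combination -hs

/-- The finite form of the Jacobi triple product. -/
theorem finite_triple_product {p X : ℂ} (hp : ‖p ^ 2‖ < 1) (hp0 : p ≠ 0) (hX : X ≠ 0) (n : ℕ) :
    (∏ k ∈ Finset.range n, (1 + X * (p ^ 2) ^ k)) *
      (∏ k ∈ Finset.range n, (1 + X⁻¹ * (p ^ 2) ^ (k + 1))) =
    ∑ j ∈ Finset.range (2 * n + 1), gaussBinom (p ^ 2) (2 * n) j *
      (p ^ (((j : ℤ) - n) ^ 2 - ((j : ℤ) - n)) * X ^ ((j : ℤ) - n)) := by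
  -- With `q = p²`, shifting the variable to `X q⁻ⁿ` centres the `2n` exponents: they run from `-n`
  -- to `n - 1`, and the negative ones will produce the factors in `X⁻¹`.
  have h := prod_one_add_mul_pow hp (X * ((p ^ 2) ^ n)⁻¹) (2 * n)
  have hq0 : p ^ 2 ≠ 0 := pow_ne_zero _ hp0
  have hP : ∏ k ∈ Finset.range (2 * n), (1 + X * ((p ^ 2) ^ n)⁻¹ * (p ^ 2) ^ k) =
      (X ^ n * (p ^ (n * (n + 1)))⁻¹) * ((∏ k ∈ Finset.range n, (1 + X * (p ^ 2) ^ k)) *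
      (∏ k ∈ Finset.range n, (1 + X⁻¹ * (p ^ 2) ^ (k + 1)))) := by
    rw [two_mul, Finset.prod_range_add, mul_comm]
    have e1 : ∏ x ∈ Finset.range n, (1 + X * ((p ^ 2) ^ n)⁻¹ * (p ^ 2) ^ (n + x)) =
        ∏ k ∈ Finset.range n, (1 + X * (p ^ 2) ^ k) := by
      refine Finset.prod_congr rfl fun k _ => ?_
      rw [pow_add]
      field_simp
    have e2 : ∏ x ∈ Finset.range n, (1 + X * ((p ^ 2) ^ n)⁻¹ * (p ^ 2) ^ x) =
        (X ^ n * (p ^ (n * (n + 1)))⁻¹) *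
          ∏ k ∈ Finset.range n, (1 + X⁻¹ * (p ^ 2) ^ (k + 1)) := by
      -- The monomials taken out in `1 + X q^{-k-1} = X q^{-k-1} (1 + X⁻¹ q^{k+1})`, multiplied
      -- together.
      have e3 : X ^ n * (p ^ (n * (n + 1)))⁻¹ =
          ∏ k ∈ Finset.range n, (X * ((p ^ 2) ^ (k + 1))⁻¹) := by
        rw [Finset.prod_mul_distrib, Finset.prod_const, Finset.card_range, Finset.prod_inv_distrib,
          Finset.prod_pow_eq_pow_sum, ← pow_mul, Finset.sum_add_distrib]
        congr 3
        have := Finset.sum_range_id_mul_two n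
        rcases n with _ | n
        · simp
        · simp at this ⊢; nlinarith
      rw [e3, ← Finset.prod_mul_distrib, ← Finset.prod_range_reflect]
      refine Finset.prod_congr rfl fun k hk => ?_
      have hk' : k < n := by simpa using hk
      obtain ⟨d, rfl⟩ := Nat.exists_eq_add_of_lt hk'
      have : k + d + 1 - 1 - k = d := by omega
      rw [this]
      field_simp
      ring
    rw [e1, e2]
    ring
  rw [hP] at h
  have hc : X ^ n * (p ^ (n * (n + 1)))⁻¹ ≠ 0 := by positivity
  rw [← mul_right_inj' hc, h, Finset.mul_sum]
  refine Finset.sum_congr rfl fun j _ => ?_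
  have hpow : p ^ (j * (j - 1)) = p ^ ((j : ℤ) ^ 2 - j) := by
    rw [← zpow_natCast]
    congr 1
    rcases j with _ | j
    · simp
    · push_cast [Nat.add_sub_cancel]; ring
  have hpow' : ((p ^ 2) ^ n)⁻¹ ^ j = p ^ (-((2 * n * j : ℕ) : ℤ)) := by
    rw [zpow_neg, zpow_natCast, inv_pow, ← pow_mul, ← pow_mul, mul_assoc]
  have hpow'' : (p ^ (n * (n + 1)))⁻¹ = p ^ (-((n * (n + 1) : ℕ) : ℤ)) := by
    rw [zpow_neg, zpow_natCast]
  rw [hpow, mul_pow, hpow', hpow'', ← zpow_natCast X j, ← zpow_natCast X n]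
  have a1 : (X : ℂ) ^ ((n : ℕ) : ℤ) * X ^ ((j : ℤ) - n) = X ^ (j : ℤ) := by
    rw [← zpow_add₀ hX]; congr 1; ring
  have a2 : p ^ (-((n * (n + 1) : ℕ) : ℤ)) * p ^ (((j : ℤ) - n) ^ 2 - ((j : ℤ) - n)) =
      p ^ ((j : ℤ) ^ 2 - j) * p ^ (-((2 * n * j : ℕ) : ℤ)) := by
    rw [← zpow_add₀ hp0, ← zpow_add₀ hp0]; congr 1; push_cast; ring
  linear_combination (-gaussBinom (p ^ 2) (2 * n) j) * (X ^ (j : ℤ) * a2 +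
    p ^ (-((n * (n + 1) : ℕ) : ℤ)) * p ^ (((j : ℤ) - n) ^ 2 - ((j : ℤ) - n)) * a1)

theorem tendsto_qPoch {q : ℂ} (hq : ‖q‖ < 1) :
    Tendsto (qPoch q) atTop (𝓝 (∏' n : ℕ, (1 - q ^ (n + 1)))) :=
  (ModularForm.multipliable_one_sub_pow hq).hasProd.tendsto_prod_nat

theorem tprod_one_sub_pow_ne_zero {q : ℂ} (hq : ‖q‖ < 1) : ∏' n : ℕ, (1 - q ^ (n + 1)) ≠ 0 := by
  simp_rw [sub_eq_add_neg]
  refine tprod_one_add_ne_zero_of_summable (fun i => ?_) ?_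
  · rw [← sub_eq_add_neg]; exact one_sub_pow_ne_zero hq i
  · simpa using (summable_nat_add_iff 1).mpr (summable_geometric_of_lt_one (norm_nonneg _) hq)

/-- The Pochhammer symbols and their inverses both converge, hence are bounded. Uniformity in `m`
and `j` supplies the dominating series for the triple product. -/
theorem exists_norm_gaussBinom_le {q : ℂ} (hq : ‖q‖ < 1) :
    ∃ C : ℝ, ∀ m j, ‖gaussBinom q m j‖ ≤ C := by
  obtain ⟨A, hA⟩ := (tendsto_qPoch hq).norm.bddAbove_range
  obtain ⟨B, hB⟩ := ((tendsto_qPoch hq).inv₀ (tprod_one_sub_pow_ne_zero hq)).norm.bddAbove_range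
  have hA' : ∀ n, ‖qPoch q n‖ ≤ A := fun n => hA ⟨n, rfl⟩
  have hB' : ∀ n, ‖(qPoch q n)⁻¹‖ ≤ B := fun n => hB ⟨n, rfl⟩
  have hA0 : 0 ≤ A := (norm_nonneg _).trans (hA' 0)
  have hB0 : 0 ≤ B := (norm_nonneg _).trans (hB' 0)
  refine ⟨A * (B * B), fun m j => ?_⟩
  rw [gaussBinom]
  split_ifs
  · rw [div_eq_mul_inv, mul_inv, norm_mul, norm_mul]
    gcongr <;> first | exact hA' _ | exact hB' _
  · rw [norm_zero]; positivity

/-- All three Pochhammer indices tend to infinity, so the limit is `Q / (Q * Q)`; the truncation in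
`toNat` plays no role once `n ≥ |k|`. -/
theorem tendsto_gaussBinom {q : ℂ} (hq : ‖q‖ < 1) (k : ℤ) :
    Tendsto (fun n : ℕ => gaussBinom q (2 * n) (n + k).toNat) atTop
      (𝓝 (∏' n : ℕ, (1 - q ^ (n + 1)))⁻¹) := by
  set Q := ∏' n : ℕ, (1 - q ^ (n + 1))
  have hQ : Q ≠ 0 := tprod_one_sub_pow_ne_zero hq
  have h1 : Tendsto (fun n : ℕ => 2 * n) atTop atTop :=
    tendsto_atTop_mono (fun n => (by omega : n ≤ 2 * n)) tendsto_id
  have h2 : Tendsto (fun n : ℕ => (n + k).toNat) atTop atTop :=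
    tendsto_atTop.mpr fun b => (eventually_ge_atTop (b + k.natAbs)).mono fun n hn => by omega
  have h3 : Tendsto (fun n : ℕ => 2 * n - (n + k).toNat) atTop atTop :=
    tendsto_atTop.mpr fun b => (eventually_ge_atTop (b + k.natAbs)).mono fun n hn => by omega
  have h := ((tendsto_qPoch hq).comp h1).div
    (((tendsto_qPoch hq).comp h2).mul ((tendsto_qPoch hq).comp h3)) (mul_ne_zero hQ hQ)
  have e : Q / (Q * Q) = Q⁻¹ := by field_simp
  rw [e] at h
  refine h.congr' ((eventually_ge_atTop k.natAbs).mono fun n hn => ?_)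
  have hle : (n + k).toNat ≤ 2 * n := by omega
  simp [gaussBinom, hle]

theorem summable_norm_mul_pow {q : ℂ} (hq : ‖q‖ < 1) (c : ℂ) (r : ℕ) :
    Summable fun n : ℕ => ‖c * q ^ (n + r)‖ := by
  simp_rw [norm_mul, norm_pow]
  exact ((summable_nat_add_iff r).mpr (summable_geometric_of_lt_one (norm_nonneg _) hq)).mul_left _

/-- The Jacobi triple product. -/
theorem jacobiTheta₂_eq_tprod (z : ℂ) {τ : ℂ} (hτ : 0 < τ.im) :
    jacobiTheta₂ z τ = (∏' n : ℕ, (1 - cexp (2 * Real.pi * I * τ) ^ (n + 1))) *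
      ((∏' n : ℕ, (1 + cexp (2 * Real.pi * I * (z + τ / 2)) * cexp (2 * Real.pi * I * τ) ^ n)) *
      (∏' n : ℕ, (1 + (cexp (2 * Real.pi * I * (z + τ / 2)))⁻¹ *
        cexp (2 * Real.pi * I * τ) ^ (n + 1)))) := by
  set p := cexp (Real.pi * I * τ) with hp
  set X := cexp (2 * Real.pi * I * (z + τ / 2)) with hX
  have hq : cexp (2 * Real.pi * I * τ) = p ^ 2 := by rw [hp, ← Complex.exp_nat_mul]; ring_nf
  rw [hq]
  have hp0 : p ≠ 0 := exp_ne_zero _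
  have hX0 : X ≠ 0 := exp_ne_zero _
  have hp1 : ‖p ^ 2‖ < 1 := by
    rw [← hq, Complex.norm_exp, Real.exp_lt_one_iff]
    simp
    positivity
  set Q := ∏' n : ℕ, (1 - (p ^ 2) ^ (n + 1))
  have hQ : Q ≠ 0 := tprod_one_sub_pow_ne_zero hp1
  have hterm : ∀ k : ℤ, p ^ (k ^ 2 - k) * X ^ k = jacobiTheta₂_term k z τ := by
    intro k
    rw [hp, hX, ← Complex.exp_int_mul, ← Complex.exp_int_mul, ← Complex.exp_add, jacobiTheta₂_term]
    congr 1
    push_cast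
    ring
  have hL : Tendsto (fun n : ℕ => (∏ k ∈ Finset.range n, (1 + X * (p ^ 2) ^ k)) *
      (∏ k ∈ Finset.range n, (1 + X⁻¹ * (p ^ 2) ^ (k + 1)))) atTop
      (𝓝 ((∏' n : ℕ, (1 + X * (p ^ 2) ^ n)) * ∏' n : ℕ, (1 + X⁻¹ * (p ^ 2) ^ (n + 1)))) :=
    ((multipliable_one_add_of_summable
      (summable_norm_mul_pow hp1 X 0)).hasProd.tendsto_prod_nat).mul
    ((multipliable_one_add_of_summable
      (summable_norm_mul_pow hp1 X⁻¹ 1)).hasProd.tendsto_prod_nat)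
  obtain ⟨C, hC⟩ := exists_norm_gaussBinom_le hp1
  have hC0 : 0 ≤ C := (norm_nonneg _).trans (hC 0 0)
  -- Extension by zero places the finite sums on the common index set `ℤ`, where dominated
  -- convergence applies.
  let F : ℕ → ℤ → ℂ := fun n k => if k.natAbs ≤ n then
    gaussBinom (p ^ 2) (2 * n) (n + k).toNat * jacobiTheta₂_term k z τ else 0
  have hF : ∀ n, (∏ k ∈ Finset.range n, (1 + X * (p ^ 2) ^ k)) *
      (∏ k ∈ Finset.range n, (1 + X⁻¹ * (p ^ 2) ^ (k + 1))) = ∑' k, F n k := by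
    intro n
    rw [finite_triple_product hp1 hp0 hX0, tsum_eq_sum (s := Finset.Icc (-n : ℤ) n)]
    · refine Finset.sum_bij' (fun j _ => (j : ℤ) - n) (fun k _ => (n + k).toNat) ?_ ?_ ?_ ?_ ?_
      · intro j hj; simp at hj ⊢; omega
      · intro k hk; simp at hk ⊢; omega
      · intro j hj; simp
      · intro k hk; simp at hk ⊢; omega
      · intro j hj
        simp only [Finset.mem_range] at hj
        have h1 : ((j : ℤ) - n).natAbs ≤ n := by omega
        simp only [F, if_pos h1]
        rw [hterm]
        simp
    · intro k hk
      simp only [Finset.mem_Icc, not_and_or, not_le] at hk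
      simp only [F]
      rw [if_neg (by omega)]
  have hR : Tendsto (fun n => ∑' k, F n k) atTop (𝓝 (∑' k, Q⁻¹ * jacobiTheta₂_term k z τ)) := by
    refine tendsto_tsum_of_dominated_convergence
      (bound := fun k => C * ‖jacobiTheta₂_term k z τ‖) ?_ ?_ ?_
    · exact ((summable_jacobiTheta₂_term_iff z τ).mpr hτ).norm.mul_left _
    · intro k
      refine ((tendsto_gaussBinom hp1 k).mul_const _).congr' ?_
      filter_upwards [eventually_ge_atTop k.natAbs] with n hn
      simp only [F, if_pos hn]
    · refine Eventually.of_forall fun n k => ?_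
      simp only [F]
      split_ifs
      · rw [norm_mul]; gcongr; exact hC _ _
      · rw [norm_zero]; positivity
  have := tendsto_nhds_unique (hL.congr hF) hR
  rw [this, tsum_mul_left, mul_inv_cancel_left₀ hQ]
  rfl

end

section

/-! ### Densities along Shokurov cycles -/

theorem oneForm_apply {V : Type} [NormedAddCommGroup V] [NormedSpace ℝ V] (l : V →L[ℝ] ℂ) (x : V) :
    oneForm l ![x] = l x := by
  simp [oneForm]

theorem conjForm_apply {V : Type} [NormedAddCommGroup V] [NormedSpace ℝ V] {k : ℕ} (α : Alt V k)
    (x : Fin k → V) : conjForm α x = (starRingEnd ℂ) (α x) := rfl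

theorem piProj_apply {V : Type} [NormedAddCommGroup V] [NormedSpace ℝ V] {k : ℕ} (n : ℕ)
    (α : Alt V k) (x : Fin k → V) :
    piProj n α x = 1 / 2 * (α x + (-1) ^ n * (starRingEnd ℂ) (α x)) := rfl

theorem pullE_apply {N k : ℕ} (α : FormY N k) (h : GL (Fin 2) (ZMod N)) (x : ℂ × ℂ)
    (w : Fin k → ℂ × ℂ) : pullE α h x w = α h x.1 (fun i => (w i).1) := rfl

theorem hasFDerivAt_shokurovParam (m n : ℤ) (p : ℝ × ℝ) :
    HasFDerivAt (shokurovParam m n)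
      (((I : ℂ) • (ofRealCLM.comp (ContinuousLinearMap.fst ℝ ℝ ℝ))).prod
        ((p.2 : ℂ) • ((m : ℂ) • (I : ℂ) • (ofRealCLM.comp (ContinuousLinearMap.fst ℝ ℝ ℝ))) +
          ((m : ℂ) * (I * p.1) + n) • (ofRealCLM.comp (ContinuousLinearMap.snd ℝ ℝ ℝ)))) p := by
  have h1 : HasFDerivAt (fun p : ℝ × ℝ => (p.1 : ℂ))
      (ofRealCLM.comp (ContinuousLinearMap.fst ℝ ℝ ℝ)) p :=
    (ofRealCLM.comp (ContinuousLinearMap.fst ℝ ℝ ℝ)).hasFDerivAt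
  have h2 : HasFDerivAt (fun p : ℝ × ℝ => (p.2 : ℂ))
      (ofRealCLM.comp (ContinuousLinearMap.snd ℝ ℝ ℝ)) p :=
    (ofRealCLM.comp (ContinuousLinearMap.snd ℝ ℝ ℝ)).hasFDerivAt
  exact (h1.const_mul I).prodMk (h2.mul (((h1.const_mul I).const_mul (m : ℂ)).add_const (n : ℂ)))

theorem shokurovDensity_apply {N : ℕ} (m n : ℤ) (ω : FormE N 2) (p : ℝ × ℝ) :
    shokurovDensity m n ω p = ω (sigma N) (shokurovParam m n p)
      ![(I, p.2 * (m * I)), (0, m * (I * p.1) + n)] := by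
  rw [shokurovDensity, (hasFDerivAt_shokurovParam m n p).fderiv,
    ContinuousAlternatingMap.compContinuousLinearMap_apply]
  congr 1
  ext i <;> fin_cases i <;> simp

variable {N : ℕ} [NeZero N]

/-- The vector `∂/∂t` has no `τ`-component, so `dτ ∧ dz` only sees `dτ(∂/∂y) = i` and `dz(∂/∂t) = mτ
+ n`, and `t` disappears. The `i` cancels the one in `3/(πiN)`, so that `π₂` takes a real part. -/
theorem shokurovDensity_eta1 (u v : Fin 2 → ZMod N) (m n : ℤ) (p : ℝ × ℝ) :
    shokurovDensity m n (eta1 u v) p =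
      ((2 / N * Real.log ‖siegelUnit u (I * p.1)‖ *
        (3 / (Real.pi * N) * (eisSeries 3 0 v (I * p.1) * (m * (I * p.1) + n)).re) : ℝ) : ℂ) := by
  rw [shokurovDensity_apply]
  simp only [eta1, Eis0D, Eis1hol, onSheet_sigma, shokurovParam,
    ContinuousAlternatingMap.smul_apply, piProj_apply, wedge_apply, dτ, dz, oneForm_apply]
  simp only [ContinuousLinearMap.coe_fst', ContinuousLinearMap.coe_snd', smul_eq_mul, zero_mul,
    sub_zero, even_two, Even.neg_pow, one_pow, one_mul, add_conj]
  have hpi : (Real.pi : ℂ) ≠ 0 := by exact_mod_cast Real.pi_ne_zero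
  have : 3 / (Real.pi * I * N) * eisSeries 3 0 v (I * p.1) * (I * (m * (I * p.1) + n)) =
      ((3 / (Real.pi * N) : ℝ) : ℂ) * (eisSeries 3 0 v (I * p.1) * (m * (I * p.1) + n)) := by
    push_cast
    field_simp
  rw [this, re_ofReal_mul]
  push_cast
  ring

/-- The first factor comes from the base and kills `∂/∂t`, so only `Dz(∂/∂t) = mτ + n` matters and
`t` disappears. As `dτ = i dy` on the axis, `π₁` leaves `i` times the real part of the logarithmic
derivative. -/
theorem shokurovDensity_eta2 (u v : Fin 2 → ZMod N) (m n : ℤ) (p : ℝ × ℝ) :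
    shokurovDensity m n (eta2 u v) p =
      -(I * (2 / N * (logDeriv (siegelUnit u) (I * p.1)).re : ℝ)) *
        ((3 * p.1 / (2 * Real.pi * N) : ℝ) *
        (eisSeries 2 1 v (I * p.1) * (m * (I * p.1) + n) +
          eisSeries 1 2 v (I * p.1) * (starRingEnd ℂ) (m * (I * p.1) + n))) := by
  rw [shokurovDensity_apply]
  simp only [eta2, Eis0hol, Eis1D, onSheet_sigma, shokurovParam, Dz, dτY,
    ContinuousAlternatingMap.smul_apply, ContinuousAlternatingMap.neg_apply,
    ContinuousAlternatingMap.add_apply, ContinuousAlternatingMap.sub_apply,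
    pullE_apply, conjForm_apply, piProj_apply, wedge_apply, dτ, dz, oneForm_apply]
  have e : ∀ x : ℂ × ℂ, (fun i : Fin 1 => (![x] i).1) = ![x.1] := fun x => by
    ext i; fin_cases i; rfl
  simp only [e, oneForm_apply]
  have h2 : (I * (p.1 : ℂ)).im = p.1 := by simp
  simp only [ContinuousLinearMap.coe_fst', ContinuousLinearMap.coe_snd', smul_eq_mul,
    ContinuousLinearMap.id_apply, h2, pow_one]
  set g := logDeriv (siegelUnit u) (I * p.1)
  have h3 : (2 / N * g * I : ℂ) + -1 * (starRingEnd ℂ) (2 / N * g * I) =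
      2 * (I * (2 / N * g.re : ℝ)) := by
    have : (2 / N * g * I : ℂ) = ((2 / N : ℝ) : ℂ) * (g * I) := by push_cast; ring
    rw [this]
    apply Complex.ext
    · simp
    · simp
      ring
  rw [h3]
  simp

end

section

/-! ### Siegel units as functions on the unit disc -/

section DiscProduct

variable {c : ℂ} {e : ℕ → ℕ}

theorem norm_mul_pow_le (hc : ‖c‖ ≤ 1) (he : ∀ n, n + 1 ≤ e n) {r : ℝ} (hr : r < 1) {w : ℂ}
    (hw : ‖w‖ ≤ r) (n : ℕ) : ‖-(c * w ^ e n)‖ ≤ r ^ (n + 1) := by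
  have hr0 : 0 ≤ r := (norm_nonneg _).trans hw
  rw [norm_neg, norm_mul, norm_pow]
  calc ‖c‖ * ‖w‖ ^ e n ≤ 1 * r ^ e n := by gcongr
    _ ≤ r ^ (n + 1) := by rw [one_mul]; exact pow_le_pow_of_le_one hr0 hr.le (he n)

theorem summable_norm_disc (hc : ‖c‖ ≤ 1) (he : ∀ n, n + 1 ≤ e n) {w : ℂ} (hw : ‖w‖ < 1) :
    Summable fun n => ‖-(c * w ^ e n)‖ :=
  Summable.of_nonneg_of_le (fun _ => norm_nonneg _) (norm_mul_pow_le hc he hw le_rfl)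
    ((summable_nat_add_iff 1).mpr (summable_geometric_of_lt_one (norm_nonneg _) hw))

theorem disc_factor_ne_zero (hc : ‖c‖ ≤ 1) (he : ∀ n, n + 1 ≤ e n) {w : ℂ} (hw : ‖w‖ < 1) (n : ℕ) :
    1 + -(c * w ^ e n) ≠ 0 := by
  intro h
  have h1 : ‖-(c * w ^ e n)‖ = 1 := by
    rw [← neg_eq_of_add_eq_zero_right h, norm_neg, norm_one]
  have h2 := norm_mul_pow_le hc he hw le_rfl n
  have h3 : ‖w‖ ^ (n + 1) < 1 := pow_lt_one₀ (norm_nonneg w) hw n.succ_ne_zero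
  linarith

theorem disc_tprod_ne_zero (hc : ‖c‖ ≤ 1) (he : ∀ n, n + 1 ≤ e n) {w : ℂ} (hw : ‖w‖ < 1) :
    ∏' n, (1 - c * w ^ e n) ≠ 0 := by
  simp_rw [sub_eq_add_neg]
  exact tprod_one_add_ne_zero_of_summable (disc_factor_ne_zero hc he hw) (summable_norm_disc hc he hw)

theorem disc_tprod_zero (he : ∀ n, n + 1 ≤ e n) : ∏' n, (1 - c * (0 : ℂ) ^ e n) = 1 := by
  have : ∀ n, (1 - c * (0 : ℂ) ^ e n) = 1 := fun n => by
    rw [zero_pow (by have := he n; omega)]; simp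
  simp [this]

/-- On a compact subset of the disc the factors are dominated by a geometric series whose ratio is
the maximum of `‖w‖`, so convergence is locally uniform. -/
theorem differentiableOn_disc_tprod (hc : ‖c‖ ≤ 1) (he : ∀ n, n + 1 ≤ e n) :
    DifferentiableOn ℂ (fun w => ∏' n, (1 - c * w ^ e n)) (Metric.ball 0 1) := by
  simp_rw [sub_eq_add_neg]
  have : HasProdLocallyUniformlyOn (fun n w => 1 + -(c * w ^ e n))
      (fun w => ∏' n, (1 + -(c * w ^ e n))) (Metric.ball (0 : ℂ) 1) := by
    refine hasProdLocallyUniformlyOn_of_forall_compact Metric.isOpen_ball fun K hK hcK => ?_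
    rcases K.eq_empty_or_nonempty with hN | hN
    · simpa [hasProdUniformlyOn_iff_tendstoUniformlyOn, hN] using tendstoUniformlyOn_empty
    · obtain ⟨q₀, hq₀, _, HB⟩ := hcK.exists_sSup_image_eq_and_ge hN
        (show ContinuousOn (fun q : ℂ ↦ ‖q‖) K by fun_prop)
      have hq1 : ‖q₀‖ < 1 := by simpa using hK hq₀
      exact ((summable_nat_add_iff 1).mpr
        (summable_geometric_of_lt_one (norm_nonneg _) hq1)).hasProdUniformlyOn_nat_one_add
        hcK (.of_forall fun n x hx => norm_mul_pow_le hc he hq1 (HB x hx) n) fun _ => by fun_prop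
  exact TendstoLocallyUniformlyOn.differentiableOn this
    (.of_forall fun _ => by simpa [Finset.prod_fn] using
      DifferentiableOn.finsetProd (fun _ _ => by fun_prop)) Metric.isOpen_ball

end DiscProduct

theorem bernFract_eq {N : ℕ} (k : ℕ) (x : ZMod N) :
    bernFract k x = bernoulliFun k ((x.val : ℝ) / N) := by
  rw [bernFract, bernoulliFun, Polynomial.eval_map_algebraMap]

theorem bernFract_two {N : ℕ} (x : ZMod N) :
    bernFract 2 x = ((x.val : ℝ) / N) ^ 2 - (x.val : ℝ) / N + 6⁻¹ := by
  rw [bernFract_eq, bernoulliFun_two]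

variable {N : ℕ} [NeZero N]

theorem norm_zetaPow (b : ZMod N) : ‖zetaPow b‖ = 1 := by
  rw [zetaPow, ZMod.stdAddChar_apply, Circle.norm_coe]

theorem zetaPow_eq (b : ZMod N) : zetaPow b = cexp (2 * Real.pi * I * b.val / N) := by
  rw [zetaPow, ZMod.stdAddChar_apply, ZMod.toCircle_apply]

theorem zetaPow_neg (b : ZMod N) : zetaPow (-b) = (zetaPow b)⁻¹ := by
  rw [zetaPow, zetaPow, AddChar.map_neg_eq_inv]

theorem zetaPow_eq_one_iff (b : ZMod N) : zetaPow b = 1 ↔ b = 0 := by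
  rw [zetaPow, ← AddChar.map_zero_eq_one (ZMod.stdAddChar (N := N))]
  exact ZMod.injective_stdAddChar.eq_iff

/-- The constant term of the Siegel unit as a function on the disc. -/
noncomputable def siegelConst (u : Fin 2 → ZMod N) : ℂ := if u 0 = 0 then 1 - zetaPow (u 1) else 1

/-- The Siegel unit, divided by its leading term, in the variable `exp (2πiτ/N)`. -/
noncomputable def siegelDisc (u : Fin 2 → ZMod N) (w : ℂ) : ℂ :=
  (∏' n : ℕ, (1 - zetaPow (u 1) * w ^ (if u 0 = 0 then (n + 1) * N else n * N + (u 0).val))) *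
    ∏' n : ℕ, (1 - zetaPow (-(u 1)) * w ^ ((n + 1) * N - (u 0).val))

theorem siegelConst_ne_zero {u : Fin 2 → ZMod N} (hu : u ≠ 0) : siegelConst u ≠ 0 := by
  rw [siegelConst]
  split_ifs with h
  · rw [sub_ne_zero, ne_comm, Ne, zetaPow_eq_one_iff]
    intro h'
    exact hu (by ext i; fin_cases i <;> simp [h, h'])
  · exact one_ne_zero

theorem siegelDisc_exponent₁ (u : Fin 2 → ZMod N) (n : ℕ) :
    n + 1 ≤ if u 0 = 0 then (n + 1) * N else n * N + (u 0).val := by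
  have hN : 1 ≤ N := NeZero.one_le
  split_ifs with h
  · nlinarith
  · have : 1 ≤ (u 0).val := Nat.one_le_iff_ne_zero.mpr (by simpa [ZMod.val_eq_zero] using h)
    nlinarith

theorem siegelDisc_exponent₂ (u : Fin 2 → ZMod N) (n : ℕ) :
    n + 1 ≤ (n + 1) * N - (u 0).val := by
  have h : (u 0).val < N := ZMod.val_lt _
  have : (n + 1) * N = n * N + N := by ring
  have : n ≤ n * N := Nat.le_mul_of_pos_right _ (by omega)
  omega

theorem siegelDisc_ne_zero (u : Fin 2 → ZMod N) {w : ℂ} (hw : ‖w‖ < 1) : siegelDisc u w ≠ 0 :=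
  mul_ne_zero (disc_tprod_ne_zero (norm_zetaPow _).le (siegelDisc_exponent₁ u) hw)
    (disc_tprod_ne_zero (norm_zetaPow _).le (siegelDisc_exponent₂ u) hw)

theorem siegelDisc_zero (u : Fin 2 → ZMod N) : siegelDisc u 0 = 1 := by
  rw [siegelDisc, disc_tprod_zero (siegelDisc_exponent₁ u), disc_tprod_zero (siegelDisc_exponent₂ u),
    one_mul]

theorem differentiableOn_siegelDisc (u : Fin 2 → ZMod N) :
    DifferentiableOn ℂ (siegelDisc u) (Metric.ball 0 1) :=
  (differentiableOn_disc_tprod (norm_zetaPow _).le (siegelDisc_exponent₁ u)).mul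
    (differentiableOn_disc_tprod (norm_zetaPow _).le (siegelDisc_exponent₂ u))

/-- The parameter `exp (2πiτ/N)`. -/
noncomputable def discParam (N : ℕ) (τ : ℂ) : ℂ := cexp (2 * Real.pi * I * τ / N)

omit [NeZero N] in
theorem norm_discParam (τ : ℂ) : ‖discParam N τ‖ = Real.exp (-(2 * Real.pi / N) * τ.im) := by
  have : 2 * Real.pi * I * τ / N = ((2 * Real.pi / N : ℝ) : ℂ) * (I * τ) := by
    push_cast; ring
  rw [discParam, Complex.norm_exp, this, re_ofReal_mul]
  simp

theorem norm_discParam_lt_one {τ : ℂ} (hτ : 0 < τ.im) : ‖discParam N τ‖ < 1 := by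
  have hN : (0 : ℝ) < N := by exact_mod_cast NeZero.pos N
  rw [norm_discParam, Real.exp_lt_one_iff, neg_mul, neg_lt_zero]
  positivity

theorem discParam_pow (τ : ℂ) (k : ℕ) (x : ℝ) (hx : x * N = k) :
    qPow x τ = discParam N τ ^ k := by
  have hN : (N : ℂ) ≠ 0 := by exact_mod_cast NeZero.ne N
  have hx' : (x : ℂ) * N = k := by exact_mod_cast hx
  rw [qPow, discParam, ← Complex.exp_nat_mul, ← hx']
  congr 1
  field_simp

/-- If `u 0 = 0`, the factor `n = 0` of the first product is a constant. It is moved into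
`siegelConst` and the rest reindexed, so that only positive powers of the disc parameter remain. -/
theorem siegelUnit_eq (u : Fin 2 → ZMod N) {τ : ℂ} (hτ : 0 < τ.im) :
    siegelUnit u τ =
      qPow (bernFract 2 (u 0) / 2) τ * (siegelConst u * siegelDisc u (discParam N τ)) := by
  have hN : (N : ℝ) ≠ 0 := by exact_mod_cast NeZero.ne N
  have h1 : ∀ n : ℕ, qPow ((n : ℝ) + ((u 0).val : ℝ) / N) τ =
      discParam N τ ^ (n * N + (u 0).val) := fun n => by
    apply discParam_pow; push_cast; field_simp
  have h2 : ∀ n : ℕ, qPow (((n : ℝ) + 1) - ((u 0).val : ℝ) / N) τ =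
      discParam N τ ^ ((n + 1) * N - (u 0).val) := fun n => by
    apply discParam_pow
    have h : (u 0).val ≤ (n + 1) * N :=
      (ZMod.val_lt (u 0)).le.trans (Nat.le_mul_of_pos_left _ (by omega))
    push_cast [Nat.cast_sub h]; field_simp
  have h3 : ∏' n : ℕ, (1 - discParam N τ ^ (n * N + (u 0).val) * zetaPow (u 1)) =
      siegelConst u * ∏' n : ℕ, (1 - zetaPow (u 1) *
        discParam N τ ^ (if u 0 = 0 then (n + 1) * N else n * N + (u 0).val)) := by
    rw [siegelConst]
    split_ifs with h
    · have hm := multipliable_one_add_of_summable (summable_norm_disc (norm_zetaPow (u 1)).le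
        (siegelDisc_exponent₁ u) (norm_discParam_lt_one (N := N) hτ))
      have h0 : (u 0).val = 0 := by rw [h, ZMod.val_zero]
      simp only [if_pos h, ← sub_eq_add_neg] at hm
      have := tprod_eq_zero_mul' (f := fun n : ℕ => 1 - zetaPow (u 1) * discParam N τ ^ (n * N)) hm
      simp only [zero_mul, pow_zero, mul_one] at this
      simp only [h0, add_zero, mul_comm _ (zetaPow (u 1)), this]
    · simp only [one_mul, mul_comm _ (zetaPow (u 1))]
  rw [siegelUnit, siegelDisc]
  simp only [h1, h2]
  rw [h3]
  simp only [mul_comm (zetaPow (-(u 1)))]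
  ring

theorem siegelUnit_ne_zero {u : Fin 2 → ZMod N} (hu : u ≠ 0) {τ : ℂ} (hτ : 0 < τ.im) :
    siegelUnit u τ ≠ 0 := by
  rw [siegelUnit_eq u hτ]
  exact mul_ne_zero (exp_ne_zero _) (mul_ne_zero (siegelConst_ne_zero hu)
    (siegelDisc_ne_zero u (norm_discParam_lt_one hτ)))

theorem isOpen_im_pos : IsOpen {τ : ℂ | 0 < τ.im} := isOpen_lt continuous_const continuous_im

theorem differentiable_qPow (x : ℝ) : Differentiable ℂ (qPow x) := by
  unfold qPow; fun_prop

omit [NeZero N] in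
theorem differentiable_discParam : Differentiable ℂ (discParam N) := by
  unfold discParam; fun_prop

theorem differentiableAt_siegelDisc (u : Fin 2 → ZMod N) {w : ℂ} (hw : ‖w‖ < 1) :
    DifferentiableAt ℂ (siegelDisc u) w :=
  (differentiableOn_siegelDisc u).differentiableAt (Metric.isOpen_ball.mem_nhds (by simpa using hw))

theorem differentiableOn_siegelUnit (u : Fin 2 → ZMod N) :
    DifferentiableOn ℂ (siegelUnit u) {τ | 0 < τ.im} := by
  refine DifferentiableOn.congr (fun τ hτ => ?_) (fun τ hτ => siegelUnit_eq u hτ)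
  exact (((differentiable_qPow _ _).mul (((differentiableAt_siegelDisc u
    (norm_discParam_lt_one hτ)).comp τ (differentiable_discParam τ)).const_mul _))
    ).differentiableWithinAt

theorem logDeriv_siegelUnit {u : Fin 2 → ZMod N} (hu : u ≠ 0) {τ : ℂ} (hτ : 0 < τ.im) :
    logDeriv (siegelUnit u) τ = 2 * Real.pi * I * ((bernFract 2 (u 0) / 2 : ℝ) +
      discParam N τ / N * logDeriv (siegelDisc u) (discParam N τ)) := by
  have hev : siegelUnit u =ᶠ[𝓝 τ] fun τ => qPow (bernFract 2 (u 0) / 2) τ *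
      (siegelConst u * siegelDisc u (discParam N τ)) :=
    (isOpen_im_pos.mem_nhds hτ : {τ : ℂ | 0 < τ.im} ∈ 𝓝 τ) |> fun h =>
      Filter.mem_of_superset h fun τ hτ => siegelUnit_eq u hτ
  have hd := differentiableAt_siegelDisc u (norm_discParam_lt_one (N := N) hτ)
  have hc : DifferentiableAt ℂ (fun τ => siegelDisc u (discParam N τ)) τ :=
    hd.comp τ (differentiable_discParam τ)
  have hne := siegelDisc_ne_zero u (norm_discParam_lt_one (N := N) hτ)
  have hq : ∀ x : ℝ, HasDerivAt (qPow x) (qPow x τ * (2 * Real.pi * I * x)) τ := fun x => by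
    have := ((hasDerivAt_id τ).const_mul (2 * Real.pi * I * x : ℂ)).cexp
    unfold qPow
    simpa only [mul_one, id_eq] using this
  have hw : HasDerivAt (discParam N) (discParam N τ * (2 * Real.pi * I / N)) τ := by
    have := (((hasDerivAt_id τ).const_mul (2 * Real.pi * I : ℂ)).div_const (N : ℂ)).cexp
    unfold discParam
    simpa only [mul_one, id_eq] using this
  have hl : logDeriv (siegelUnit u) τ = logDeriv (fun τ => qPow (bernFract 2 (u 0) / 2) τ *
      (siegelConst u * siegelDisc u (discParam N τ))) τ := by
    rw [logDeriv_apply, logDeriv_apply, hev.deriv_eq, hev.eq_of_nhds]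
  rw [hl, logDeriv_mul (f := qPow (bernFract 2 (u 0) / 2))
    (g := fun τ => siegelConst u * siegelDisc u (discParam N τ)) τ (exp_ne_zero _) (mul_ne_zero (siegelConst_ne_zero hu) hne)
    (differentiable_qPow _ _) (hc.const_mul _), logDeriv_const_mul τ _ (siegelConst_ne_zero hu),
    show (fun τ => siegelDisc u (discParam N τ)) = siegelDisc u ∘ discParam N from rfl,
    logDeriv_comp hd (differentiable_discParam τ), hw.deriv, logDeriv_apply, (hq _).deriv,
    mul_div_cancel_left₀ _ (show qPow _ τ ≠ 0 from exp_ne_zero _)]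
  ring

end

section

/-! ### Siegel units near the cusp `i∞` -/

variable {N : ℕ} [NeZero N]

theorem im_I_mul_ofReal_pos {y : ℝ} (hy : 0 < y) : 0 < (I * (y : ℂ)).im := by simpa using hy

omit [NeZero N] in
theorem isBigO_discParam :
    (fun y : ℝ => discParam N (I * y)) =O[atTop] fun y : ℝ => Real.exp (-(2 * Real.pi / N) * y) := by
  refine IsBigO.of_bound 1 (Eventually.of_forall fun y => ?_)
  rw [norm_discParam]
  simp

theorem two_pi_div_pos : 0 < 2 * Real.pi / N := by
  have hN : (0 : ℝ) < N := by exact_mod_cast NeZero.pos N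
  positivity

theorem tendsto_exp_neg_mul_atTop {b : ℝ} (hb : 0 < b) :
    Tendsto (fun y : ℝ => Real.exp (-b * y)) atTop (𝓝 0) :=
  Real.tendsto_exp_atBot.comp (tendsto_id.const_mul_atTop_of_neg (neg_neg_of_pos hb))

theorem tendsto_discParam : Tendsto (fun y : ℝ => discParam N (I * y)) atTop (𝓝 0) :=
  isBigO_discParam.trans_tendsto (tendsto_exp_neg_mul_atTop two_pi_div_pos)

theorem norm_qPow (x : ℝ) (τ : ℂ) : ‖qPow x τ‖ = Real.exp (-2 * Real.pi * x * τ.im) := by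
  have : 2 * Real.pi * I * x * τ = ((2 * Real.pi * x : ℝ) : ℂ) * (I * τ) := by
    push_cast; ring
  rw [qPow, Complex.norm_exp, this, re_ofReal_mul]
  simp

/-- `log (siegelDisc u w)` is differentiable at `w = 0` and vanishes there, so it is `O(w)`. -/
theorem log_norm_siegelUnit_isBigO {u : Fin 2 → ZMod N} (hu : u ≠ 0) :
    (fun y : ℝ => Real.log ‖siegelUnit u (I * y)‖ -
      (-Real.pi * bernFract 2 (u 0) * y + Real.log ‖siegelConst u‖)) =O[atTop]
      fun y : ℝ => Real.exp (-(2 * Real.pi / N) * y) := by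
  have hd : DifferentiableAt ℂ (fun w => Complex.log (siegelDisc u w)) 0 :=
    (differentiableAt_siegelDisc u (by simp)).clog (by rw [siegelDisc_zero]; exact one_mem_slitPlane)
  have h := hd.isBigO_sub
  simp only [siegelDisc_zero, Complex.log_one, sub_zero] at h
  refine IsBigO.trans ?_ ((h.comp_tendsto tendsto_discParam).trans isBigO_discParam)
  refine IsBigO.of_bound 1 ?_
  filter_upwards [eventually_gt_atTop 0] with y hy
  have hτ := im_I_mul_ofReal_pos hy
  have hne := siegelDisc_ne_zero u (norm_discParam_lt_one (N := N) hτ)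
  have : Real.log ‖siegelUnit u (I * y)‖ -
      (-Real.pi * bernFract 2 (u 0) * y + Real.log ‖siegelConst u‖) =
      (Complex.log (siegelDisc u (discParam N (I * y)))).re := by
    rw [siegelUnit_eq u hτ, norm_mul, norm_mul, norm_qPow, Real.log_mul (Real.exp_ne_zero _)
      (mul_ne_zero (norm_ne_zero_iff.mpr (siegelConst_ne_zero hu)) (norm_ne_zero_iff.mpr hne)),
      Real.log_mul (norm_ne_zero_iff.mpr (siegelConst_ne_zero hu)) (norm_ne_zero_iff.mpr hne),
      Real.log_exp, Complex.log_re]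
    simp
    ring
  rw [this, one_mul]
  exact abs_re_le_norm _

/-- The leading power of `q` contributes `πi B₂`, which is imaginary. What survives in the real part
is the disc parameter times a function continuous at `0`. -/
theorem re_logDeriv_siegelUnit_isBigO {u : Fin 2 → ZMod N} (hu : u ≠ 0) :
    (fun y : ℝ => (logDeriv (siegelUnit u) (I * y)).re) =O[atTop]
      fun y : ℝ => Real.exp (-(2 * Real.pi / N) * y) := by
  have hA : AnalyticAt ℂ (siegelDisc u) 0 :=
    (differentiableOn_siegelDisc u).analyticAt (Metric.isOpen_ball.mem_nhds (by simp))
  have hc : ContinuousAt (logDeriv (siegelDisc u)) 0 :=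
    hA.deriv.continuousAt.div hA.continuousAt (by rw [siegelDisc_zero]; exact one_ne_zero)
  have h1 := (hc.tendsto.comp (tendsto_discParam (N := N))).isBigO_one ℝ
  have h2 := (isBigO_discParam (N := N)).mul h1
  simp only [mul_one] at h2
  refine IsBigO.trans ?_ h2
  refine IsBigO.of_bound (2 * Real.pi / N) ?_
  filter_upwards [eventually_gt_atTop 0] with y hy
  rw [logDeriv_siegelUnit hu (im_I_mul_ofReal_pos hy)]
  set A := discParam N (I * y)
  set B := logDeriv (siegelDisc u) A
  have : (2 * Real.pi * I * ((bernFract 2 (u 0) / 2 : ℝ) + A / N * B)).re =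
      ((2 * Real.pi / N : ℝ) * (I * (A * B))).re := by
    have e : 2 * Real.pi * I * ((bernFract 2 (u 0) / 2 : ℝ) + A / N * B) =
      ((2 * Real.pi * (bernFract 2 (u 0) / 2) : ℝ) : ℂ) * I +
      (2 * Real.pi / N : ℝ) * (I * (A * B)) := by push_cast; ring
    rw [e, add_re, re_ofReal_mul]
    simp
  rw [this]
  refine (abs_re_le_norm _).trans ?_
  rw [norm_mul, norm_mul, norm_I, one_mul, norm_real, Real.norm_eq_abs,
    abs_of_pos two_pi_div_pos]
  rfl

/-! ### The transformation of Siegel units under `τ ↦ -1/τ` -/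

/-- A theta function with real characteristics `α, β`, divided by the eta function. -/
noncomputable def thetaQuot (α β : ℝ) (τ : ℂ) : ℂ :=
  cexp (Real.pi * I * α ^ 2 * τ) * jacobiTheta₂ (β + α * τ) τ / ModularForm.eta τ

/-- The `1/2` in the second characteristic gives the minus sign in the factors, the `-1/2` in the
first cancels the `τ/2` of the triple product, and the leading powers agree because `B₂(x)/2 + 1/24
= (x - 1/2)²/2`. -/
theorem siegelUnit_eq_thetaQuot (u : Fin 2 → ZMod N) {τ : ℂ} (hτ : 0 < τ.im) :
    siegelUnit u τ =
      thetaQuot (((u 0).val : ℝ) / N - 1 / 2) (((u 1).val : ℝ) / N + 1 / 2) τ := by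
  have hq : ‖cexp (2 * Real.pi * I * τ)‖ < 1 := by
    rw [Complex.norm_exp, Real.exp_lt_one_iff]
    simp
    positivity
  have hQ := tprod_one_sub_pow_ne_zero hq
  have hX : cexp (2 * Real.pi * I * (((((u 1).val : ℝ) / N + 1 / 2 : ℝ) : ℂ) +
      (((u 0).val : ℝ) / N - 1 / 2 : ℝ) * τ + τ / 2)) =
      -(qPow (((u 0).val : ℝ) / N) τ * zetaPow (u 1)) := by
    rw [zetaPow_eq, qPow, ← Complex.exp_add, neg_eq_neg_one_mul, ← exp_pi_mul_I, ← Complex.exp_add]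
    congr 1
    push_cast
    ring
  have hpow : ∀ (x : ℝ) (n : ℕ), qPow x τ * cexp (2 * Real.pi * I * τ) ^ n = qPow (n + x) τ := by
    intro x n
    rw [qPow, qPow, ← Complex.exp_nat_mul, ← Complex.exp_add]
    congr 1
    push_cast
    ring
  have hinv : (qPow (((u 0).val : ℝ) / N) τ)⁻¹ = qPow (-(((u 0).val : ℝ) / N)) τ := by
    rw [qPow, qPow, ← Complex.exp_neg]
    congr 1
    push_cast
    ring
  have heta : ModularForm.eta τ = qPow (1 / 24) τ *
      ∏' n : ℕ, (1 - cexp (2 * Real.pi * I * τ) ^ (n + 1)) := by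
    rw [ModularForm.eta, qPow]
    congr 1
    · rw [Function.Periodic.qParam]
      congr 1
      push_cast
      ring
    · refine tprod_congr fun n => ?_
      rw [ModularForm.eta_q_eq_pow]
  rw [thetaQuot, jacobiTheta₂_eq_tprod _ hτ, hX, heta, siegelUnit]
  have h1 : ∀ n : ℕ, 1 + -(qPow (((u 0).val : ℝ) / N) τ * zetaPow (u 1)) *
      cexp (2 * Real.pi * I * τ) ^ n =
      1 - qPow ((n : ℝ) + ((u 0).val : ℝ) / N) τ * zetaPow (u 1) := by
    intro n
    rw [← hpow]
    ring
  have h2 : ∀ n : ℕ, 1 + (-(qPow (((u 0).val : ℝ) / N) τ * zetaPow (u 1)))⁻¹ *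
      cexp (2 * Real.pi * I * τ) ^ (n + 1) =
      1 - qPow (((n : ℝ) + 1) - ((u 0).val : ℝ) / N) τ * zetaPow (-(u 1)) := by
    intro n
    rw [inv_neg, mul_inv, hinv, zetaPow_neg, sub_eq_add_neg ((n : ℝ) + 1)]
    have := hpow (-(((u 0).val : ℝ) / N)) (n + 1)
    rw [Nat.cast_add, Nat.cast_one] at this
    rw [← this]
    ring
  simp only [h1, h2]
  have h3 : qPow (bernFract 2 (u 0) / 2) τ * qPow (1 / 24) τ =
      cexp (Real.pi * I * (((u 0).val : ℝ) / N - 1 / 2 : ℝ) ^ 2 * τ) := by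
    rw [qPow, qPow, ← Complex.exp_add, bernFract_two]
    congr 1
    push_cast
    ring
  rw [← h3]
  have hq24 : qPow (1 / 24) τ ≠ 0 := exp_ne_zero _
  rw [eq_div_iff (mul_ne_zero hq24 hQ)]
  ring

theorem thetaQuot_add_one_left (α β : ℝ) (τ : ℂ) :
    thetaQuot (α + 1) β τ = cexp (-(2 * Real.pi * β : ℝ) * I) * thetaQuot α β τ := by
  have e : (β : ℂ) + ((α + 1 : ℝ) : ℂ) * τ = (β + α * τ) + τ := by push_cast; ring
  rw [thetaQuot, e, jacobiTheta₂_add_left', thetaQuot, ← mul_assoc, ← mul_div_assoc, ← mul_assoc,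
    ← Complex.exp_add, ← Complex.exp_add]
  congr 3
  push_cast
  ring

theorem thetaQuot_add_one_right (α β : ℝ) (τ : ℂ) : thetaQuot α (β + 1) τ = thetaQuot α β τ := by
  have e : ((β + 1 : ℝ) : ℂ) + α * τ = (β + α * τ) + 1 := by push_cast; ring
  rw [thetaQuot, e, jacobiTheta₂_add_left, thetaQuot]

/-- Reconciles the branches in the functional equations of `jacobiTheta₂` and `ModularForm.eta`: as
`arg τ ∈ [0, π]`, adding `arg (-I) = -π/2` never leaves the principal range. -/
theorem neg_I_mul_cpow_half {τ : ℂ} (hτ : 0 < τ.im) :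
    (-I * τ) ^ (1 / 2 : ℂ) = (Complex.sqrt I)⁻¹ * Complex.sqrt τ := by
  have hτ0 : τ ≠ 0 := by rintro rfl; simp at hτ
  have hlog : Complex.log (-I * τ) = Complex.log (-I) + Complex.log τ := by
    refine Complex.log_mul (neg_ne_zero.mpr I_ne_zero) hτ0 ?_
    rw [arg_neg_I]
    have h1 : 0 ≤ τ.arg := arg_nonneg_iff.mpr hτ.le
    have h2 := arg_le_pi τ
    have := Real.pi_pos
    constructor <;> linarith
  rw [cpow_def_of_ne_zero (mul_ne_zero (neg_ne_zero.mpr I_ne_zero) hτ0), hlog, Complex.sqrt,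
    Complex.sqrt, cpow_def_of_ne_zero I_ne_zero, cpow_def_of_ne_zero hτ0, ← Complex.exp_neg,
    ← Complex.exp_add, log_neg_I, log_I]
  congr 1
  ring

/-- The weight `1/2` factors of theta and eta cancel. The argument `β + ατ` divided by `τ` is `-(-α
+ β(-1/τ))`, and theta is even, so the characteristics turn from `(α, β)` into `(β, -α)`. -/
theorem thetaQuot_S (α β : ℝ) {τ : ℂ} (hτ : 0 < τ.im) :
    thetaQuot α β τ = cexp (-(2 * Real.pi * (α * β) : ℝ) * I) * thetaQuot β (-α) (-1 / τ) := by
  have hτ0 : τ ≠ 0 := by rintro rfl; simp at hτ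
  have hη : ModularForm.eta (-1 / τ) =
      (Complex.sqrt I)⁻¹ * (Complex.sqrt τ * ModularForm.eta τ) :=
    ModularForm.eta_comp_eq_csqrt_I_inv hτ
  have hs : ∀ z : ℂ, z ≠ 0 → Complex.sqrt z ≠ 0 := fun z hz => by
    rw [Complex.sqrt, cpow_def_of_ne_zero hz]; exact exp_ne_zero _
  have hη0 := ModularForm.eta_ne_zero (z := τ) hτ
  have hs1 := hs I I_ne_zero
  have hs2 := hs τ hτ0
  have e1 : ((β : ℂ) + α * τ) / τ = -((-α : ℝ) + β * (-1 / τ)) := by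
    push_cast; field_simp; ring
  have e2 : cexp (Real.pi * I * α ^ 2 * τ) * cexp (-Real.pi * I * (β + α * τ) ^ 2 / τ) =
      cexp (-(2 * Real.pi * (α * β) : ℝ) * I) * cexp (Real.pi * I * β ^ 2 * (-1 / τ)) := by
    rw [← Complex.exp_add, ← Complex.exp_add]
    congr 1
    push_cast
    field_simp
    ring
  rw [thetaQuot, thetaQuot, jacobiTheta₂_functional_equation, hη, neg_I_mul_cpow_half hτ, e1,
    jacobiTheta₂_neg_left]
  generalize jacobiTheta₂ ((-α : ℝ) + β * (-1 / τ)) (-1 / τ) = T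
  generalize cexp (Real.pi * I * β ^ 2 * (-1 / τ)) = E₁ at *
  generalize cexp (-(2 * Real.pi * (α * β) : ℝ) * I) = E₂ at *
  generalize cexp (Real.pi * I * α ^ 2 * τ) = E₃ at *
  generalize cexp (-Real.pi * I * (β + α * τ) ^ 2 / τ) = E₄ at *
  field_simp
  linear_combination T * e2

/-- The action of `σ` on row vectors. -/
def rot (u : Fin 2 → ZMod N) : Fin 2 → ZMod N := ![u 1, -u 0]

/-- The constant `c` has modulus one and does not depend on `τ`, so it is invisible to both
`log|g_u|` and `dlog g_u`. -/
theorem siegelUnit_S (u : Fin 2 → ZMod N) : ∃ c : ℂ, ‖c‖ = 1 ∧ ∀ τ : ℂ, 0 < τ.im →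
    siegelUnit u τ = c * siegelUnit (rot u) (-1 / τ) := by
  have hN : (N : ℝ) ≠ 0 := by exact_mod_cast NeZero.ne N
  set α : ℝ := ((u 0).val : ℝ) / N - 1 / 2
  set β : ℝ := ((u 1).val : ℝ) / N + 1 / 2
  have hrot : ∀ τ, thetaQuot (β - 1) (-α) τ = thetaQuot (((rot u 0).val : ℝ) / N - 1 / 2)
      (((rot u 1).val : ℝ) / N + 1 / 2) τ := by
    intro τ
    have e0 : ((rot u 0).val : ℝ) / N - 1 / 2 = β - 1 := by simp only [rot, β]; simp; ring
    rw [e0]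
    have hv : (rot u 1) = -u 0 := by simp [rot]
    -- The representative of `-a` is `N - a` unless `a = 0`; for `a ≠ 0` the second characteristic
    -- moves by `1`, which changes nothing.
    rw [hv, ZMod.neg_val]
    split_ifs with h
    · have : -α = ((0 : ℕ) : ℝ) / N + 1 / 2 := by simp [α, h]
      rw [this]
    · have : ((N - (u 0).val : ℕ) : ℝ) / N + 1 / 2 = -α + 1 := by
        rw [Nat.cast_sub (ZMod.val_lt _).le]
        simp only [α]
        field_simp
        ring
      rw [this, thetaQuot_add_one_right]
  refine ⟨cexp (-(2 * Real.pi * (α * β) : ℝ) * I) * cexp (-(2 * Real.pi * -α : ℝ) * I), ?_, ?_⟩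
  · rw [← ofReal_neg, ← ofReal_neg, norm_mul, norm_exp_ofReal_mul_I, norm_exp_ofReal_mul_I, one_mul]
  · intro τ hτ
    have hτ' : 0 < (-1 / τ).im := by
      have : 0 < normSq τ := normSq_pos.mpr (by rintro rfl; simp at hτ)
      rw [neg_div, one_div, neg_im, inv_im]
      simp only [neg_div, neg_neg]
      positivity
    rw [siegelUnit_eq_thetaQuot u hτ, siegelUnit_eq_thetaQuot _ hτ', ← hrot, thetaQuot_S _ _ hτ,
      mul_assoc (cexp _), ← thetaQuot_add_one_left, sub_add_cancel]

theorem neg_one_div_I_mul (y : ℝ) : -1 / (I * (y : ℂ)) = I * ((y⁻¹ : ℝ) : ℂ) := by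
  push_cast
  rw [neg_div, one_div, mul_inv, inv_I]
  ring

theorem log_norm_siegelUnit_inv (u : Fin 2 → ZMod N) {y : ℝ} (hy : 0 < y) :
    Real.log ‖siegelUnit u (I * (y⁻¹ : ℝ))‖ = Real.log ‖siegelUnit (rot u) (I * y)‖ := by
  obtain ⟨c, hc, h⟩ := siegelUnit_S u
  rw [h _ (im_I_mul_ofReal_pos (inv_pos.mpr hy)), neg_one_div_I_mul, inv_inv, norm_mul, hc, one_mul]

theorem logDeriv_siegelUnit_inv (u : Fin 2 → ZMod N) {y : ℝ} (hy : 0 < y) :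
    logDeriv (siegelUnit u) (I * (y⁻¹ : ℝ)) =
      ((-y ^ 2 : ℝ) : ℂ) * logDeriv (siegelUnit (rot u)) (I * y) := by
  obtain ⟨c, hc, h⟩ := siegelUnit_S u
  have hc0 : c ≠ 0 := by rintro rfl; simp at hc
  set τ : ℂ := I * (y⁻¹ : ℝ)
  have hτ : 0 < τ.im := im_I_mul_ofReal_pos (inv_pos.mpr hy)
  have hτ0 : τ ≠ 0 := by intro h0; simp [h0] at hτ
  have hev : siegelUnit u =ᶠ[𝓝 τ] fun τ => c * (siegelUnit (rot u) ∘ fun τ => -1 / τ) τ :=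
    Filter.mem_of_superset (isOpen_im_pos.mem_nhds hτ) h
  have hy' : -1 / τ = I * y := by simp only [τ]; rw [neg_one_div_I_mul, inv_inv]
  have hd : DifferentiableAt ℂ (siegelUnit (rot u)) (-1 / τ) := by
    rw [hy']
    exact (differentiableOn_siegelUnit _).differentiableAt
      (isOpen_im_pos.mem_nhds (im_I_mul_ofReal_pos hy))
  have hS : HasDerivAt (fun τ : ℂ => -1 / τ) (1 / τ ^ 2) τ := by
    have := (hasDerivAt_inv hτ0).neg
    simp only [neg_neg] at this
    have e : (fun τ : ℂ => -1 / τ) = -fun y => y⁻¹ := by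
      ext z; rw [neg_div, one_div]; rfl
    rw [e, one_div]
    exact this
  have hl : logDeriv (siegelUnit u) τ =
      logDeriv (fun τ => c * (siegelUnit (rot u) ∘ fun τ => -1 / τ) τ) τ := by
    rw [logDeriv_apply, logDeriv_apply, hev.deriv_eq, hev.eq_of_nhds]
  rw [hl, logDeriv_const_mul τ c hc0, logDeriv_comp hd hS.differentiableAt, hS.deriv, hy', mul_comm]
  congr 1
  have hyc : (y : ℂ) ≠ 0 := by exact_mod_cast hy.ne'
  simp only [τ]
  push_cast
  rw [mul_pow, I_sq]
  field_simp

theorem siegelConst_log (u : Fin 2 → ZMod N) : Real.log ‖siegelConst u‖ =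
    if u 0 = 0 then Real.log ‖1 - zetaPow (u 1)‖ else 0 := by
  rw [siegelConst]; split_ifs <;> simp

omit [NeZero N] in
theorem rot_ne_zero {u : Fin 2 → ZMod N} (hu : u ≠ 0) : rot u ≠ 0 := by
  intro h
  have h0 := congrFun h 0
  have h1 := congrFun h 1
  simp [rot] at h0 h1
  exact hu (by ext i; fin_cases i <;> simp [h0, h1])

theorem continuousOn_log_norm_siegelUnit {u : Fin 2 → ZMod N} (hu : u ≠ 0) :
    ContinuousOn (fun y : ℝ => Real.log ‖siegelUnit u (I * y)‖) (Set.Ioi 0) := by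
  refine ContinuousOn.log (ContinuousOn.norm ?_)
    fun y hy => norm_ne_zero_iff.mpr (siegelUnit_ne_zero hu (im_I_mul_ofReal_pos hy))
  exact (differentiableOn_siegelUnit u).continuousOn.comp (by fun_prop)
    fun y hy => im_I_mul_ofReal_pos hy

theorem continuousOn_logDeriv_siegelUnit {u : Fin 2 → ZMod N} (hu : u ≠ 0) :
    ContinuousOn (fun y : ℝ => logDeriv (siegelUnit u) (I * y)) (Set.Ioi 0) := by
  have h : ContinuousOn (logDeriv (siegelUnit u)) {τ | 0 < τ.im} :=
    ((differentiableOn_siegelUnit u).deriv isOpen_im_pos).continuousOn.div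
      (differentiableOn_siegelUnit u).continuousOn fun τ hτ => siegelUnit_ne_zero hu hτ
  exact h.comp (by fun_prop) fun y hy => im_I_mul_ofReal_pos hy

end

section

/-! ### Eisenstein series on the imaginary axis -/

theorem summable_int_prod_norm_cube : Summable fun p : ℤ × ℤ => (‖p‖ ^ 3)⁻¹ := by
  have h := EisensteinSeries.summable_one_div_norm_rpow (k := 3) (by norm_num)
  rw [← (finTwoArrowEquiv ℤ).symm.summable_iff] at h
  refine h.congr fun p => ?_
  have : ‖(finTwoArrowEquiv ℤ).symm p‖ = ‖p‖ := by
    rw [finTwoArrowEquiv_symm_apply, Prod.norm_def]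
    simp [Pi.norm_def, Finset.univ_fin2]
  simp only [Function.comp_apply]
  rw [this, Real.rpow_neg (norm_nonneg _)]
  norm_cast

theorem min_mul_norm_le {y : ℝ} (hy : 0 < y) (p : ℤ × ℤ) :
    min 1 y * ‖p‖ ≤ ‖(p.1 : ℂ) * (I * y) + p.2‖ := by
  have hre : ((p.1 : ℂ) * (I * y) + p.2).re = p.2 := by simp
  have him : ((p.1 : ℂ) * (I * y) + p.2).im = p.1 * y := by simp
  have h1 := abs_re_le_norm ((p.1 : ℂ) * (I * y) + p.2)
  have h2 := abs_im_le_norm ((p.1 : ℂ) * (I * y) + p.2)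
  rw [hre] at h1
  rw [him, abs_mul, abs_of_pos hy] at h2
  have hm : 0 < min 1 y := lt_min one_pos hy
  rw [Prod.norm_def, mul_max_of_nonneg _ _ hm.le, Int.norm_eq_abs, Int.norm_eq_abs]
  refine max_le ?_ ?_
  · calc min 1 y * |(p.1 : ℝ)| ≤ y * |(p.1 : ℝ)| := by gcongr; exact min_le_right _ _
      _ ≤ _ := by rw [mul_comm]; exact h2
  · calc min 1 y * |(p.2 : ℝ)| ≤ 1 * |(p.2 : ℝ)| := by gcongr; exact min_le_left _ _
      _ ≤ _ := by rw [one_mul]; exact h1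

variable {N : ℕ} [NeZero N]

/-- The general term of the Eisenstein series. -/
noncomputable def eisTerm (a b : ℕ) (v : Fin 2 → ZMod N) (τ : ℂ) (p : ℤ × ℤ) : ℂ :=
  zetaPow (v 0 * (p.2 : ZMod N) - v 1 * (p.1 : ZMod N)) /
    (((p.1 : ℂ) * τ + p.2) ^ a * ((p.1 : ℂ) * (starRingEnd ℂ) τ + p.2) ^ b)

/-- At `p = 0` the term is a division by `0^3 = 0`, hence `0` by convention, and the excluded index
can be restored. -/
theorem eisSeries_eq (a b : ℕ) (hab : a + b = 3) (v : Fin 2 → ZMod N) (τ : ℂ) :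
    eisSeries a b v τ = ∑' p, eisTerm a b v τ p := by
  refine tsum_subtype_eq_of_support_subset (s := {p : ℤ × ℤ | p ≠ 0}) (f := eisTerm a b v τ)
    fun p hp => ?_
  rintro rfl
  apply hp
  have : (0 : ℂ) ^ a * 0 ^ b = 0 := by rw [← pow_add, hab]; simp
  simp [eisTerm, this]

theorem norm_eisTerm_le {a b : ℕ} (hab : a + b = 3) (v : Fin 2 → ZMod N) {δ y : ℝ} (hδ : 0 < δ)
    (hy : δ ≤ y) (p : ℤ × ℤ) :
    ‖eisTerm a b v (I * y) p‖ ≤ ((min 1 δ) ^ 3)⁻¹ * (‖p‖ ^ 3)⁻¹ := by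
  rcases eq_or_ne p 0 with rfl | hp
  · have : (0 : ℂ) ^ a * 0 ^ b = 0 := by rw [← pow_add, hab]; simp
    simp [eisTerm, this]
  have h1 : ‖(p.1 : ℂ) * (starRingEnd ℂ) (I * y) + p.2‖ = ‖(p.1 : ℂ) * (I * y) + p.2‖ := by
    rw [← norm_conj ((p.1 : ℂ) * (I * y) + p.2)]
    congr 1
    simp
  rw [eisTerm, norm_div, norm_zetaPow, norm_mul, norm_pow, norm_pow, h1, ← pow_add, hab, one_div,
    ← mul_inv, ← mul_pow]
  have hp' : 0 < ‖p‖ := norm_pos_iff.mpr hp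
  have hm : 0 < min 1 δ := lt_min one_pos hδ
  gcongr
  calc min 1 δ * ‖p‖ ≤ min 1 y * ‖p‖ := by gcongr
    _ ≤ _ := min_mul_norm_le (hδ.trans_le hy) p

theorem summable_eisTerm {a b : ℕ} (hab : a + b = 3) (v : Fin 2 → ZMod N) {y : ℝ} (hy : 0 < y) :
    Summable (eisTerm a b v (I * y)) :=
  Summable.of_norm_bounded (summable_int_prod_norm_cube.mul_left _)
    (norm_eisTerm_le hab v hy le_rfl)

theorem continuousOn_eisSeries {a b : ℕ} (hab : a + b = 3) (v : Fin 2 → ZMod N) :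
    ContinuousOn (fun y : ℝ => eisSeries a b v (I * y)) (Set.Ioi 0) := by
  intro y₀ (hy₀ : 0 < y₀)
  have h : ContinuousOn (fun y : ℝ => ∑' p, eisTerm a b v (I * y) p) (Set.Ioi (y₀ / 2)) := by
    refine continuousOn_tsum (fun p => ?_)
      (summable_int_prod_norm_cube.mul_left ((min 1 (y₀ / 2)) ^ 3)⁻¹)
      fun p y hy => norm_eisTerm_le hab v (half_pos hy₀) (le_of_lt hy) p
    rcases eq_or_ne p 0 with rfl | hp
    · have : (0 : ℂ) ^ a * 0 ^ b = 0 := by rw [← pow_add, hab]; simp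
      simp only [eisTerm, Prod.fst_zero, Prod.snd_zero, Int.cast_zero, zero_mul, add_zero, this,
        div_zero]
      exact continuousOn_const
    · refine ContinuousOn.div continuousOn_const ?_ fun y hy => ?_
      · have : Continuous fun y : ℝ => (starRingEnd ℂ) (I * y) := by fun_prop
        fun_prop
      · have hy' : 0 < y := (half_pos hy₀).trans hy
        have h1 : (p.1 : ℂ) * (I * y) + p.2 ≠ 0 := by
          rw [← norm_pos_iff]
          exact (mul_pos (lt_min one_pos hy') (norm_pos_iff.mpr hp)).trans_le (min_mul_norm_le hy' p)
        have h2 : (p.1 : ℂ) * (starRingEnd ℂ) (I * y) + p.2 =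
            (starRingEnd ℂ) ((p.1 : ℂ) * (I * y) + p.2) := by simp
        rw [h2]
        exact mul_ne_zero (pow_ne_zero _ h1)
          (pow_ne_zero _ ((map_ne_zero_iff _ (starRingEnd ℂ).injective).mpr h1))
  simp_rw [eisSeries_eq a b hab]
  exact (h.continuousAt (Ioi_mem_nhds (half_lt_self hy₀))).continuousWithinAt

theorem exists_norm_eisSeries_le {a b : ℕ} (hab : a + b = 3) (v : Fin 2 → ZMod N) :
    ∃ C : ℝ, ∀ y : ℝ, 0 < y → ‖eisSeries a b v (I * y)‖ ≤ C * ((min 1 y) ^ 3)⁻¹ := by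
  refine ⟨∑' p : ℤ × ℤ, (‖p‖ ^ 3)⁻¹, fun y hy => ?_⟩
  rw [eisSeries_eq a b hab]
  have h := summable_int_prod_norm_cube.hasSum.mul_left ((min 1 y) ^ 3)⁻¹
  exact (tsum_of_norm_bounded h fun p => norm_eisTerm_le hab v hy le_rfl p).trans_eq (mul_comm _ _)

theorem eisSeries_isBigO_one {a b : ℕ} (hab : a + b = 3) (v : Fin 2 → ZMod N) :
    (fun y : ℝ => eisSeries a b v (I * y)) =O[atTop] fun _ : ℝ => (1 : ℝ) := by
  obtain ⟨C, hC⟩ := exists_norm_eisSeries_le hab v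
  refine IsBigO.of_bound C ?_
  filter_upwards [eventually_ge_atTop 1] with y hy
  simpa [min_eq_left hy] using hC y (by linarith)

/-- A crude bound at the cusp `0`, also valid for the non-holomorphic series; it suffices for `η²`,
where it meets an exponentially small factor. -/
theorem eisSeries_inv_isBigO {a b : ℕ} (hab : a + b = 3) (v : Fin 2 → ZMod N) :
    (fun y : ℝ => eisSeries a b v (I * (y⁻¹ : ℝ))) =O[atTop] fun y : ℝ => y ^ 3 := by
  obtain ⟨C, hC⟩ := exists_norm_eisSeries_le hab v
  refine IsBigO.of_bound C ?_
  filter_upwards [eventually_ge_atTop 1] with y hy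
  have hy0 : 0 < y := by linarith
  have := hC y⁻¹ (inv_pos.mpr hy0)
  rwa [min_eq_right (inv_le_one_of_one_le₀ hy), inv_pow, inv_inv,
    ← Real.norm_of_nonneg (pow_nonneg hy0.le 3)] at this

/-- Reindexing by `(m, n) ↦ (n, -m)` takes a factor `iy` out of each linear form, and `(iy)³ =
-iy³`. The odd weight is what makes inversion swap real and imaginary parts. -/
theorem eisSeries_inv (v : Fin 2 → ZMod N) {y : ℝ} (hy : 0 < y) :
    eisSeries 3 0 v (I * (y⁻¹ : ℝ)) = -I * y ^ 3 * eisSeries 3 0 (rot v) (I * y) := by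
  let e : ℤ × ℤ ≃ ℤ × ℤ :=
    ⟨fun p => (p.2, -p.1), fun p => (-p.2, p.1), fun p => by simp, fun p => by simp⟩
  rw [eisSeries_eq 3 0 rfl, eisSeries_eq 3 0 rfl, ← tsum_mul_left,
    ← e.tsum_eq (fun p => -I * y ^ 3 * eisTerm 3 0 (rot v) (I * y) p)]
  refine tsum_congr fun p => ?_
  have hyc : (y : ℂ) ≠ 0 := by exact_mod_cast hy.ne'
  have h1 : rot v 0 * ((e p).2 : ZMod N) - rot v 1 * ((e p).1 : ZMod N) =
      v 0 * (p.2 : ZMod N) - v 1 * (p.1 : ZMod N) := by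
    simp [rot, e]
    ring
  have h2 : ((e p).1 : ℂ) * (I * y) + (e p).2 =
      (I * y) * ((p.1 : ℂ) * (I * (y⁻¹ : ℝ)) + p.2) := by
    simp only [e, Equiv.coe_fn_mk]
    push_cast
    field_simp
    linear_combination (-(p.1 : ℂ)) * I_sq
  rw [eisTerm, eisTerm, h1, h2]
  set A := (p.1 : ℂ) * (I * (y⁻¹ : ℝ)) + p.2
  have h3 : (I * (y : ℂ) * A) ^ 3 = -I * y ^ 3 * A ^ 3 := by
    linear_combination (I * y ^ 3 * A ^ 3) * I_sq
  rw [pow_zero, pow_zero, mul_one, mul_one, h3, ← mul_div_assoc,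
    mul_div_mul_left _ _ (mul_ne_zero (neg_ne_zero.mpr I_ne_zero) (pow_ne_zero 3 hyc))]

/-! ### Constant term and exponential remainder of the weight 3 Eisenstein series. -/

theorem exists_norm_tsum_one_div_cube_le {δ : ℝ} (hδ : 0 < δ) : ∃ C : ℝ, 0 ≤ C ∧ ∀ z : ℂ,
    δ ≤ |z.im| → ‖∑' l : ℤ, 1 / (z + l) ^ 3‖ ≤ C * Real.exp (-(2 * Real.pi) * |z.im|) := by
  set ρ₀ := Real.exp (-(2 * Real.pi) * δ) with hρ₀
  have hρ₀pos : 0 < ρ₀ := Real.exp_pos _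
  have hρ₀lt : ρ₀ < 1 := by rw [hρ₀, Real.exp_lt_one_iff]; nlinarith [Real.pi_pos]
  have hs : Summable fun n : ℕ => (n : ℝ) ^ 2 * ρ₀ ^ n :=
    summable_pow_mul_geometric_of_norm_lt_one 2 (by rwa [Real.norm_of_nonneg hρ₀pos.le])
  set S := ∑' n : ℕ, (n : ℝ) ^ 2 * ρ₀ ^ n
  have hS : 0 ≤ S := tsum_nonneg fun n => by positivity
  have hpos : ∀ z : ℂ, δ ≤ z.im → ‖∑' l : ℤ, 1 / (z + l) ^ 3‖ ≤
      ((2 * Real.pi) ^ 3 / 2 * (S / ρ₀)) * Real.exp (-(2 * Real.pi) * z.im) := by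
    intro z hz
    -- Lipschitz's formula gives a multiple of `∑ n² e^{2πinz}`. Its `n = 0` term vanishes, so a
    -- full factor `e^{-2π Im z}` comes out; comparison with height `δ` makes the constant uniform.
    have h := EisensteinSeries.qExpansion_identity (k := 2) (by norm_num) ⟨z, hδ.trans_le hz⟩
    norm_num only at h
    rw [h, norm_mul]
    set ρ := Real.exp (-(2 * Real.pi) * z.im) with hρ
    have hρle : ρ ≤ ρ₀ := by
      rw [hρ, hρ₀, Real.exp_le_exp]
      nlinarith [Real.pi_pos]
    have hρpos : 0 < ρ := Real.exp_pos _
    have hn : ‖cexp (2 * Real.pi * I * z)‖ = ρ := by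
      rw [Complex.norm_exp]
      simp [hρ]
    have hb : ‖∑' n : ℕ, (n : ℂ) ^ 2 * cexp (2 * Real.pi * I * z) ^ n‖ ≤ (ρ / ρ₀) * S := by
      refine tsum_of_norm_bounded (hs.hasSum.mul_left (ρ / ρ₀)) fun n => ?_
      rw [norm_mul, norm_pow, norm_pow, hn, Complex.norm_natCast]
      rcases n with _ | n
      · simp
      · have : ρ ^ (n + 1) ≤ ρ / ρ₀ * ρ₀ ^ (n + 1) := by
          rw [pow_succ, pow_succ, div_mul_eq_mul_div, le_div_iff₀ hρ₀pos]
          have : ρ ^ n ≤ ρ₀ ^ n := by gcongr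
          nlinarith [mul_pos hρpos hρ₀pos]
        calc _ ≤ ((n + 1 : ℕ) : ℝ) ^ 2 * (ρ / ρ₀ * ρ₀ ^ (n + 1)) := by gcongr
          _ = _ := by ring
    have hc : ‖(-2 * Real.pi * I : ℂ) ^ 3 / 2‖ = (2 * Real.pi) ^ 3 / 2 := by
      simp [abs_of_pos Real.pi_pos]
    rw [hc]
    calc _ ≤ (2 * Real.pi) ^ 3 / 2 * (ρ / ρ₀ * S) := by gcongr
      _ = _ := by ring
  refine ⟨(2 * Real.pi) ^ 3 / 2 * (S / ρ₀), by positivity, fun z hz => ?_⟩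
  rcases le_total 0 z.im with h0 | h0
  · rw [abs_of_nonneg h0] at hz ⊢
    exact hpos z hz
  · rw [abs_of_nonpos h0] at hz ⊢
    have := hpos (-z) (by simpa using hz)
    rw [neg_im] at this
    rw [← (Equiv.neg ℤ).tsum_eq]
    have e : ∀ l : ℤ, 1 / (z + ((Equiv.neg ℤ l : ℤ) : ℂ)) ^ 3 = -(1 / (-z + l) ^ 3) := fun l => by
      have : z + ((Equiv.neg ℤ l : ℤ) : ℂ) = -(-z + l) := by simp; ring
      rw [this, Odd.neg_pow (by decide), div_neg]
    simp_rw [e]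
    rwa [tsum_neg, norm_neg]

/-- Splitting `n` into residue classes `r + Nl` reduces to the unweighted sum at `(τ + r)/N`. Its
height is `|Im τ|/N`, whence the exponent `2π/N`. -/
theorem exists_norm_tsum_char_div_cube_le (N : ℕ) [NeZero N] : ∃ C : ℝ, 0 ≤ C ∧
    ∀ (χ : ZMod N → ℂ) (τ : ℂ), (∀ x, ‖χ x‖ ≤ 1) → 1 ≤ |τ.im| →
      Summable (fun n : ℤ => χ n / (τ + n) ^ 3) →
      ‖∑' n : ℤ, χ n / (τ + n) ^ 3‖ ≤ C * Real.exp (-(2 * Real.pi / N) * |τ.im|) := by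
  have hN : (0 : ℝ) < N := by exact_mod_cast NeZero.pos N
  have hNc : (N : ℂ) ≠ 0 := by exact_mod_cast NeZero.ne N
  obtain ⟨C, hC0, hC⟩ := exists_norm_tsum_one_div_cube_le (δ := 1 / (N : ℝ)) (by positivity)
  refine ⟨∑ r : Fin N, C * (1 / (N : ℝ) ^ 3), by positivity, fun χ τ hχ hτ hs => ?_⟩
  obtain ⟨e, he⟩ : ∃ e : Fin N × ℤ ≃ ℤ, ∀ (r : Fin N) (l : ℤ), e (r, l) = r + N * l :=
    ⟨(Equiv.prodComm (Fin N) ℤ).trans (Int.divModEquiv N).symm, fun r l => by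
      simp [Int.divModEquiv]; ring⟩
  have hs' : Summable fun p : Fin N × ℤ => χ (e p : ℤ) / (τ + (e p : ℤ)) ^ 3 :=
    e.summable_iff.mpr hs
  rw [← e.tsum_eq, hs'.tsum_prod, tsum_fintype, Finset.sum_mul]
  refine norm_sum_le_of_le _ fun r _ => ?_
  have h1 : ∀ l : ℤ, χ (e (r, l) : ℤ) / (τ + (e (r, l) : ℤ)) ^ 3 =
      (χ (r : ℕ) * (1 / (N : ℂ) ^ 3)) * (1 / ((τ + (r : ℕ)) / N + l) ^ 3) := by
    intro l
    rw [he]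
    have : τ + ((((r : ℕ) : ℤ) + N * l : ℤ) : ℂ) = N * ((τ + (r : ℕ)) / N + l) := by
      push_cast; field_simp; ring
    rw [this, mul_pow]
    push_cast
    rw [ZMod.natCast_self, zero_mul, add_zero, mul_one_div, mul_one_div, div_div]
  simp_rw [h1]
  rw [tsum_mul_left, norm_mul]
  have him : |((τ + (r : ℕ)) / N).im| = |τ.im| / N := by
    have : (τ + (r : ℕ)) / N = (τ + (r : ℕ)) / ((N : ℝ) : ℂ) := by push_cast; rfl
    rw [this, div_ofReal_im, abs_div, abs_of_pos hN]
    simp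
  have h2 := hC ((τ + (r : ℕ)) / N) (by rw [him]; gcongr)
  rw [him] at h2
  have h3 : ‖χ (r : ℕ) * (1 / (N : ℂ) ^ 3)‖ ≤ 1 / (N : ℝ) ^ 3 := by
    rw [norm_mul, norm_div, norm_pow, Complex.norm_natCast, norm_one]
    exact mul_le_of_le_one_left (by positivity) (hχ _)
  calc _ ≤ 1 / (N : ℝ) ^ 3 * (C * Real.exp (-(2 * Real.pi) * (|τ.im| / N))) := by gcongr
    _ = C * (1 / (N : ℝ) ^ 3) * Real.exp (-(2 * Real.pi / N) * |τ.im|) := by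
      rw [show -(2 * Real.pi) * (|τ.im| / N) = -(2 * Real.pi / N) * |τ.im| by ring]; ring

/-- The Fourier expansion of `B₃` at `v/N`, with constant `-(2πi)³/3!`; the `n = 0` term is zero by
the convention for division. -/
theorem tsum_zetaPow_div_cube (v : ZMod N) :
    ∑' n : ℤ, zetaPow (v * (n : ZMod N)) / (n : ℂ) ^ 3 =
      I * (4 * Real.pi ^ 3 / 3 * bernFract 3 v : ℝ) := by
  have hN : (0 : ℝ) < N := by exact_mod_cast NeZero.pos N
  have hx : (v.val : ℝ) / N ∈ Set.Icc (0 : ℝ) 1 := by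
    refine ⟨by positivity, ?_⟩
    rw [div_le_one hN]
    exact_mod_cast (ZMod.val_lt v).le
  have h := (hasSum_one_div_pow_mul_fourier_mul_bernoulliFun (k := 3) (by norm_num) hx).tsum_eq
  rw [← bernFract_eq] at h
  have e : ∀ n : ℤ, zetaPow (v * (n : ZMod N)) / (n : ℂ) ^ 3 =
      1 / (n : ℂ) ^ 3 * fourier n (((v.val : ℝ) / N : ℝ) : AddCircle (1 : ℝ)) := by
    intro n
    have hv : v * (n : ZMod N) = (((v.val : ℤ) * n : ℤ) : ZMod N) := by simp
    rw [fourier_coe_apply, hv, zetaPow, ZMod.stdAddChar_coe, div_eq_mul_one_div, mul_comm]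
    congr 2
    push_cast
    ring
  simp_rw [e]
  rw [h]
  push_cast
  rw [mul_pow, I_pow_three]
  simp [Nat.factorial]
  ring

theorem eisSeries_isBigO (v : Fin 2 → ZMod N) :
    (fun y : ℝ => eisSeries 3 0 v (I * y) - I * (4 * Real.pi ^ 3 / 3 * bernFract 3 (v 0) : ℝ))
      =O[atTop] fun y : ℝ => Real.exp (-(2 * Real.pi / N) * y) := by
  obtain ⟨C, hC0, hC⟩ := exists_norm_tsum_char_div_cube_le N
  set b := 2 * Real.pi / N with hb
  have hbpos : 0 < b := two_pi_div_pos
  have hg : Summable fun n : ℕ => Real.exp (-b * n) := by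
    simp_rw [mul_comm (-b), Real.exp_nat_mul]
    exact summable_geometric_of_lt_one (Real.exp_pos _).le (by rw [Real.exp_lt_one_iff]; linarith)
  have hS : Summable fun m : ℤ => Real.exp (-b * |(m : ℝ)|) :=
    Summable.of_nat_of_neg (by simpa using hg) (by simpa using hg)
  set S := ∑' m : ℤ, Real.exp (-b * |(m : ℝ)|)
  -- The row `m = 0` is the constant term. In the others, `|m| y ≥ |m| + y - 1` for `|m|, y ≥ 1`
  -- separates the sum over `m` from the decay in `y`, at the cost of the factor `e^b`.
  refine IsBigO.of_bound (C * Real.exp b * S) ?_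
  filter_upwards [eventually_ge_atTop 1] with y hy
  have hy0 : 0 < y := by linarith
  have hs := summable_eisTerm (a := 3) (b := 0) rfl v hy0
  have hterm : ∀ m n : ℤ, eisTerm 3 0 v (I * y) (m, n) =
      zetaPow (v 0 * (n : ZMod N) - v 1 * (m : ZMod N)) / ((m : ℂ) * (I * y) + n) ^ 3 :=
    fun m n => by simp [eisTerm]
  rw [eisSeries_eq 3 0 rfl, hs.tsum_prod, hs.prod.tsum_eq_add_tsum_ite 0]
  have h0 : ∑' n : ℤ, eisTerm 3 0 v (I * y) (0, n) =
      I * (4 * Real.pi ^ 3 / 3 * bernFract 3 (v 0) : ℝ) := by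
    rw [← tsum_zetaPow_div_cube]
    refine tsum_congr fun n => ?_
    rw [hterm]
    simp
  rw [h0, add_sub_cancel_left, Real.norm_of_nonneg (Real.exp_pos _).le]
  have hmain : ‖∑' m : ℤ, if m = 0 then 0 else ∑' n : ℤ, eisTerm 3 0 v (I * y) (m, n)‖ ≤
      C * Real.exp b * Real.exp (-b * y) * S := by
    refine tsum_of_norm_bounded (hS.hasSum.mul_left _) fun m => ?_
    split_ifs with hm
    · rw [norm_zero]; positivity
    · have hm1 : (1 : ℝ) ≤ |(m : ℝ)| := by exact_mod_cast Int.one_le_abs hm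
      have him : |((m : ℂ) * (I * y)).im| = |(m : ℝ)| * y := by
        simp [abs_mul, abs_of_pos hy0]
      have h := hC (fun x => zetaPow (v 0 * x - v 1 * (m : ZMod N))) ((m : ℂ) * (I * y))
        (fun x => (norm_zetaPow _).le) (by rw [him]; nlinarith)
        ((hs.prod_factor m).congr fun n => hterm m n)
      simp_rw [hterm]
      refine h.trans ?_
      rw [him, mul_assoc C, mul_assoc C, ← Real.exp_add, ← Real.exp_add]
      gcongr
      nlinarith [mul_nonneg (sub_nonneg.mpr hm1) (sub_nonneg.mpr hy)]
  calc _ ≤ _ := hmain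
    _ = _ := by ring

end

section

/-! ### Integrability criteria -/

theorem integrableOn_Ioi_zero_of_isBigO {f : ℝ → ℂ} {b : ℝ} (hb : 0 < b)
    (hf : ContinuousOn f (Set.Ioi 0)) (h_inf : f =O[atTop] fun y => Real.exp (-b * y))
    (h0 : (fun y => f y⁻¹) =O[atTop] fun _ => (1 : ℝ)) : IntegrableOn f (Set.Ioi 0) := by
  obtain ⟨C, hC⟩ := h0.bound
  obtain ⟨Y, hY⟩ := eventually_atTop.mp hC
  set δ := (max Y 1)⁻¹ with hδ
  have hδ0 : 0 < δ := inv_pos.mpr (lt_max_of_lt_right one_pos)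
  have h1 : IntegrableOn f (Set.Ioc 0 δ) := by
    refine Integrable.of_bound
      ((hf.mono fun y hy => hy.1).aestronglyMeasurable measurableSet_Ioc) C ?_
    refine (ae_restrict_iff' measurableSet_Ioc).mpr (Eventually.of_forall fun y hy => ?_)
    have : Y ≤ y⁻¹ := (le_max_left Y 1).trans ((le_inv_comm₀ hy.1 (by positivity)).mp hy.2)
    simpa using hY _ this
  have h2 : IntegrableOn f (Set.Icc δ 1) :=
    (hf.mono fun y hy => hδ0.trans_le hy.1).integrableOn_Icc
  have h3 : IntegrableOn f (Set.Ioi 1) := by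
    have hf' : ContinuousOn f (Set.Ici 1) := hf.mono fun y hy =>
      (lt_of_lt_of_le one_pos hy : (0 : ℝ) < y)
    have := integrable_of_isBigO_exp_neg hb hf'.norm h_inf.norm_left
    exact (integrable_norm_iff ((hf'.mono Set.Ioi_subset_Ici_self).aestronglyMeasurable
      measurableSet_Ioi)).mp this
  refine ((h1.union h2).union h3).mono_set fun y hy => ?_
  by_cases hy1 : y ≤ δ
  · exact Or.inl (Or.inl ⟨hy, hy1⟩)
  · by_cases hy2 : y ≤ 1
    · exact Or.inl (Or.inr ⟨(not_le.mp hy1).le, hy2⟩)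
    · exact Or.inr (not_le.mp hy2)

/-- The density is constant in `t` and the `t`-interval has finite length. -/
theorem convergesAbsolutely_of_integrableOn {N : ℕ} {m n : ℤ} {ω : FormE N 2} {f : ℝ → ℂ}
    (hω : ∀ p : ℝ × ℝ, 0 < p.1 → shokurovDensity m n ω p = f p.1)
    (hf : IntegrableOn f (Set.Ioi 0)) : ConvergesAbsolutely m n ω := by
  have h : IntegrableOn (fun p : ℝ × ℝ => f p.1) (Set.Ioi (0 : ℝ) ×ˢ Set.Icc (0 : ℝ) 1) := by
    rw [IntegrableOn, Measure.volume_eq_prod, ← Measure.prod_restrict]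
    exact Integrable.comp_fst hf _
  exact h.congr_fun (fun p hp => (hω p hp.1).symm) (measurableSet_Ioi.prod measurableSet_Icc)

theorem pow_mul_exp_isBigO (k : ℕ) {b : ℝ} (hb : 0 < b) :
    (fun y : ℝ => y ^ k * Real.exp (-b * y)) =O[atTop] fun y => Real.exp (-(b / 2) * y) := by
  have h := (isLittleO_pow_exp_pos_mul_atTop k (half_pos hb)).isBigO.mul
    (isBigO_refl (fun y : ℝ => Real.exp (-b * y)) atTop)
  refine h.congr_right fun y => ?_
  rw [← Real.exp_add]
  congr 1
  ring

theorem exp_neg_isBigO_one {b : ℝ} (hb : 0 < b) :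
    (fun y : ℝ => Real.exp (-b * y)) =O[atTop] fun _ => (1 : ℝ) :=
  (tendsto_exp_neg_mul_atTop hb).isBigO_one ℝ

theorem linear_isBigO (c d : ℂ) : (fun y : ℝ => c * y + d) =O[atTop] fun y : ℝ => y := by
  refine IsBigO.add ?_ ?_
  · refine IsBigO.const_mul_left (IsBigO.of_norm_left ?_) c
    simpa using (isBigO_refl (fun y : ℝ => y) atTop).norm_left
  · exact (isLittleO_const_id_atTop d).isBigO

variable {N : ℕ} [NeZero N]

/-! ### The form `η²` -/

theorem convergesAbsolutely_eta2 {u : Fin 2 → ZMod N} (hu : u ≠ 0) (v : Fin 2 → ZMod N) (m n : ℤ) :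
    ConvergesAbsolutely m n (eta2 u v) := by
  set b := 2 * Real.pi / N with hb
  have hbpos : 0 < b := two_pi_div_pos
  let lin : ℝ → ℂ := fun y => m * (I * y) + n
  let K : ℝ → ℂ := fun y =>
    eisSeries 2 1 v (I * y) * lin y + eisSeries 1 2 v (I * y) * (starRingEnd ℂ) (lin y)
  let f : ℝ → ℂ := fun y => -(I * (2 / N * (logDeriv (siegelUnit u) (I * y)).re : ℝ)) *
    ((3 * y / (2 * Real.pi * N) : ℝ) * K y)
  let c : ℂ := -(I * (2 / N : ℝ)) * (3 / (2 * Real.pi * N) : ℝ)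
  have hf : ∀ y, f y = c * (((logDeriv (siegelUnit u) (I * y)).re : ℂ) * ((y : ℂ) * K y)) := by
    intro y; simp only [f, c]; push_cast; ring
  refine convergesAbsolutely_of_integrableOn (f := f)
    (fun p _ => shokurovDensity_eta2 u v m n p) ?_
  have hlinc : Continuous lin := by fun_prop
  refine integrableOn_Ioi_zero_of_isBigO (half_pos hbpos) ?_ ?_ ?_
  · refine ContinuousOn.congr ?_ fun y _ => hf y
    have h1 : ContinuousOn (fun y : ℝ => ((logDeriv (siegelUnit u) (I * y)).re : ℂ)) (Set.Ioi 0) :=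
      continuous_ofReal.comp_continuousOn
        (continuous_re.comp_continuousOn (continuousOn_logDeriv_siegelUnit hu))
    have h2 : ContinuousOn K (Set.Ioi 0) :=
      ((continuousOn_eisSeries rfl v).mul hlinc.continuousOn).add
        ((continuousOn_eisSeries rfl v).mul (continuous_conj.comp hlinc).continuousOn)
    exact continuousOn_const.mul (h1.mul (continuous_ofReal.continuousOn.mul h2))
  · have hlin : lin =O[atTop] fun y : ℝ => y :=
      (linear_isBigO (m * I) n).congr_left fun y => by simp only [lin]; ring
    have hlin' : (fun y => (starRingEnd ℂ) (lin y)) =O[atTop] fun y : ℝ => y :=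
      IsBigO.of_norm_left (by simpa using hlin.norm_left)
    have hK : K =O[atTop] fun y : ℝ => y :=
      (((eisSeries_isBigO_one rfl v).mul hlin).add
        ((eisSeries_isBigO_one rfl v).mul hlin')).congr_right fun y => one_mul y
    have hre : (fun y : ℝ => ((logDeriv (siegelUnit u) (I * y)).re : ℂ)) =O[atTop]
        fun y => Real.exp (-b * y) :=
      IsBigO.of_norm_left (by simpa using (re_logDeriv_siegelUnit_isBigO hu).norm_left)
    have hy : (fun y : ℝ => (y : ℂ)) =O[atTop] fun y : ℝ => y :=
      IsBigO.of_norm_left (by simpa using (isBigO_refl (fun y : ℝ => y) atTop).norm_left)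
    have := ((hre.mul (hy.mul hK)).const_mul_left c).congr (fun y => (hf y).symm)
      (g₂ := fun y : ℝ => y ^ 2 * Real.exp (-b * y)) fun y => by ring
    exact this.trans (pow_mul_exp_isBigO 2 hbpos)
  -- At the cusp `0`, the Eisenstein factor grows at most like `y³` and the chain rule for `-1/τ`
  -- adds `y²`; the decay of the rotated Siegel unit absorbs `y⁵`.
  · have hinv : (fun y : ℝ => ((y⁻¹ : ℝ) : ℂ)) =O[atTop] fun _ : ℝ => (1 : ℝ) :=
      IsBigO.of_norm_left (by
        simpa using ((tendsto_inv_atTop_zero (𝕜 := ℝ)).isBigO_one ℝ).norm_left)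
    have hlin : (fun y : ℝ => lin y⁻¹) =O[atTop] fun _ : ℝ => (1 : ℝ) :=
      (((hlinc.tendsto 0).comp tendsto_inv_atTop_zero).isBigO_one ℝ)
    have hlin' : (fun y : ℝ => (starRingEnd ℂ) (lin y⁻¹)) =O[atTop] fun _ : ℝ => (1 : ℝ) :=
      IsBigO.of_norm_left (by simpa using hlin.norm_left)
    have hK : (fun y : ℝ => K y⁻¹) =O[atTop] fun y : ℝ => y ^ 3 :=
      (((eisSeries_inv_isBigO rfl v).mul hlin).add
        ((eisSeries_inv_isBigO rfl v).mul hlin')).congr_right fun y => mul_one _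
    have hre : (fun y : ℝ => ((logDeriv (siegelUnit u) (I * (y⁻¹ : ℝ))).re : ℂ)) =O[atTop]
        fun y => y ^ 2 * Real.exp (-b * y) := by
      have h := (isBigO_refl (fun y : ℝ => y ^ 2) atTop).mul
        (re_logDeriv_siegelUnit_isBigO (rot_ne_zero hu))
      refine IsBigO.trans (IsBigO.of_bound 1 ?_) h
      filter_upwards [eventually_gt_atTop 0] with y hy
      rw [logDeriv_siegelUnit_inv u hy, re_ofReal_mul, norm_real, one_mul, norm_mul, norm_mul,
        norm_neg]
    have := ((hre.mul (hinv.mul hK)).const_mul_left c).congr (fun y => (hf y⁻¹).symm)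
      (g₂ := fun y : ℝ => y ^ 5 * Real.exp (-b * y)) fun y => by ring
    exact (this.trans (pow_mul_exp_isBigO 5 hbpos)).trans (exp_neg_isBigO_one (half_pos hbpos))

/-! ### The form `η¹` -/

/-- `∑_{u,v} φ(u,v) log |g_u| Im E_v` along the imaginary axis. -/
noncomputable def imSum (φ : (Fin 2 → ZMod N) → (Fin 2 → ZMod N) → ℂ) (y : ℝ) : ℂ :=
  ∑ u, ∑ v, φ u v * (Real.log ‖siegelUnit u (I * y)‖ * (eisSeries 3 0 v (I * y)).im : ℝ)

/-- `∑_{u,v} φ(u,v) log |g_u| Re E_v` along the imaginary axis. -/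
noncomputable def reSum (φ : (Fin 2 → ZMod N) → (Fin 2 → ZMod N) → ℂ) (y : ℝ) : ℂ :=
  ∑ u, ∑ v, φ u v * (Real.log ‖siegelUnit u (I * y)‖ * (eisSeries 3 0 v (I * y)).re : ℝ)

variable {φ : (Fin 2 → ZMod N) → (Fin 2 → ZMod N) → ℂ}

theorem shokurovDensity_eta1Lin (m n : ℤ) (p : ℝ × ℝ) :
    shokurovDensity m n (eta1Lin φ) p = ∑ u, ∑ v, φ u v * shokurovDensity m n (eta1 u v) p := by
  simp only [shokurovDensity_apply, eta1Lin, ContinuousAlternatingMap.sum_apply,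
    ContinuousAlternatingMap.smul_apply, smul_eq_mul]

theorem shokurovDensity_eta1Lin_one_zero (p : ℝ × ℝ) :
    shokurovDensity 1 0 (eta1Lin φ) p =
      ((-(6 / (Real.pi * N ^ 2)) : ℝ) : ℂ) * (p.1 * imSum φ p.1) := by
  rw [shokurovDensity_eta1Lin, imSum]
  simp only [Finset.mul_sum]
  refine Finset.sum_congr rfl fun u _ => Finset.sum_congr rfl fun v _ => ?_
  rw [shokurovDensity_eta1]
  have : (eisSeries 3 0 v (I * p.1) * (((1 : ℤ) : ℂ) * (I * p.1) + ((0 : ℤ) : ℂ))).re =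
      -(p.1 * (eisSeries 3 0 v (I * p.1)).im) := by
    simp
    ring
  rw [this]
  push_cast
  ring

theorem shokurovDensity_eta1Lin_zero_one (p : ℝ × ℝ) :
    shokurovDensity 0 1 (eta1Lin φ) p = ((6 / (Real.pi * N ^ 2) : ℝ) : ℂ) * reSum φ p.1 := by
  rw [shokurovDensity_eta1Lin, reSum]
  simp only [Finset.mul_sum]
  refine Finset.sum_congr rfl fun u _ => Finset.sum_congr rfl fun v _ => ?_
  rw [shokurovDensity_eta1]
  have : (eisSeries 3 0 v (I * p.1) * (((0 : ℤ) : ℂ) * (I * p.1) + ((1 : ℤ) : ℂ))).re =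
      (eisSeries 3 0 v (I * p.1)).re := by
    simp
  rw [this]
  push_cast
  ring

theorem continuousOn_sum_log_mul (hφ : ∀ v, φ 0 v = 0) {g : (Fin 2 → ZMod N) → ℝ → ℝ}
    (hg : ∀ v, ContinuousOn (g v) (Set.Ioi 0)) : ContinuousOn (fun y : ℝ => ∑ u, ∑ v,
      φ u v * (Real.log ‖siegelUnit u (I * y)‖ * g v y : ℝ)) (Set.Ioi 0) := by
  refine continuousOn_finsetSum _ fun u _ => continuousOn_finsetSum _ fun v _ => ?_
  rcases eq_or_ne u 0 with rfl | hu
  · simp only [hφ, zero_mul]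
    exact continuousOn_const
  · exact continuousOn_const.mul (continuous_ofReal.comp_continuousOn
      ((continuousOn_log_norm_siegelUnit hu).mul (hg v)))

theorem continuousOn_imSum (hφ : ∀ v, φ 0 v = 0) : ContinuousOn (imSum φ) (Set.Ioi 0) :=
  continuousOn_sum_log_mul hφ fun v =>
    continuous_im.comp_continuousOn (continuousOn_eisSeries (a := 3) (b := 0) rfl v)

theorem continuousOn_reSum (hφ : ∀ v, φ 0 v = 0) : ContinuousOn (reSum φ) (Set.Ioi 0) :=
  continuousOn_sum_log_mul hφ fun v =>
    continuous_re.comp_continuousOn (continuousOn_eisSeries (a := 3) (b := 0) rfl v)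

theorem real_linear_isBigO (c d : ℝ) : (fun y : ℝ => c * y + d) =O[atTop] fun y : ℝ => y :=
  ((isBigO_refl (fun y : ℝ => y) atTop).const_mul_left c).add (isLittleO_const_id_atTop d).isBigO

theorem log_norm_siegelUnit_isBigO_id {u : Fin 2 → ZMod N} (hu : u ≠ 0) :
    (fun y : ℝ => Real.log ‖siegelUnit u (I * y)‖) =O[atTop] fun y : ℝ => y := by
  have h1 := ((log_norm_siegelUnit_isBigO hu).trans (exp_neg_isBigO_one two_pi_div_pos)).trans
    (isLittleO_const_id_atTop (1 : ℝ)).isBigO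
  have := h1.add (real_linear_isBigO (-Real.pi * bernFract 2 (u 0)) (Real.log ‖siegelConst u‖))
  exact this.congr_left fun y => by ring

theorem re_eisSeries_isBigO (v : Fin 2 → ZMod N) :
    (fun y : ℝ => (eisSeries 3 0 v (I * y)).re) =O[atTop]
      fun y : ℝ => Real.exp (-(2 * Real.pi / N) * y) := by
  refine IsBigO.trans (IsBigO.of_bound 1 (Eventually.of_forall fun y => ?_)) (eisSeries_isBigO v)
  have := abs_re_le_norm
    (eisSeries 3 0 v (I * y) - I * (4 * Real.pi ^ 3 / 3 * bernFract 3 (v 0) : ℝ))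
  rw [sub_re, re_mul_ofReal, I_re, zero_mul, sub_zero] at this
  rwa [one_mul, Real.norm_eq_abs]

theorem im_eisSeries_isBigO (v : Fin 2 → ZMod N) :
    (fun y : ℝ => (eisSeries 3 0 v (I * y)).im - 4 * Real.pi ^ 3 / 3 * bernFract 3 (v 0)) =O[atTop]
      fun y : ℝ => Real.exp (-(2 * Real.pi / N) * y) := by
  refine IsBigO.trans (IsBigO.of_bound 1 (Eventually.of_forall fun y => ?_)) (eisSeries_isBigO v)
  have := abs_im_le_norm
    (eisSeries 3 0 v (I * y) - I * (4 * Real.pi ^ 3 / 3 * bernFract 3 (v 0) : ℝ))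
  rw [sub_im, im_mul_ofReal, I_im, one_mul] at this
  rwa [one_mul, Real.norm_eq_abs]

theorem isBigO_sum_mul (hφ : ∀ v, φ 0 v = 0) {F : (Fin 2 → ZMod N) → (Fin 2 → ZMod N) → ℝ → ℝ}
    {g : ℝ → ℝ} (hF : ∀ u v, u ≠ 0 → F u v =O[atTop] g) :
    (fun y : ℝ => ∑ u, ∑ v, φ u v * (F u v y : ℂ)) =O[atTop] g := by
  refine IsBigO.fun_sum fun u _ => IsBigO.fun_sum fun v _ => ?_
  rcases eq_or_ne u 0 with rfl | hu
  · simp only [hφ, zero_mul]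
    exact isBigO_zero _ _
  · exact IsBigO.const_mul_left (IsBigO.of_norm_left (by simpa using (hF u v hu).norm_left)) _

/-- Neither (C1) nor (C2) enters: the constant term of the Eisenstein series is imaginary. -/
theorem reSum_isBigO (hφ : ∀ v, φ 0 v = 0) :
    reSum φ =O[atTop] fun y : ℝ => y * Real.exp (-(2 * Real.pi / N) * y) :=
  isBigO_sum_mul hφ fun _ v hu => (log_norm_siegelUnit_isBigO_id hu).mul (re_eisSeries_isBigO v)

/-- The product of the main terms is linear in `y`. (C1) kills the coefficient of `y`; (C2) kills
the constant, because `log ‖siegelConst u‖` is zero when `u 0 ≠ 0`. -/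
theorem sum_leading_term_eq_zero (h1 : Cond1 φ) (h2 : Cond2 φ) (y : ℝ) :
    ∑ u, ∑ v, φ u v * (((-Real.pi * bernFract 2 (u 0) * y + Real.log ‖siegelConst u‖) *
      (4 * Real.pi ^ 3 / 3 * bernFract 3 (v 0)) : ℝ) : ℂ) = 0 := by
  have h2' : ∑ u, ∑ v, φ u v * (Real.log ‖siegelConst u‖ : ℂ) * (bernFract 3 (v 0) : ℂ) = 0 := by
    rw [← h2, Finset.sum_filter]
    refine Finset.sum_congr rfl fun u _ => ?_
    rw [siegelConst_log]
    split_ifs <;> simp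
  have : ∑ u, ∑ v, φ u v * (((-Real.pi * bernFract 2 (u 0) * y + Real.log ‖siegelConst u‖) *
      (4 * Real.pi ^ 3 / 3 * bernFract 3 (v 0)) : ℝ) : ℂ) =
      (-Real.pi * y * (4 * Real.pi ^ 3 / 3)) *
        ∑ u, ∑ v, φ u v * (bernFract 2 (u 0) : ℂ) * (bernFract 3 (v 0) : ℂ) +
      (4 * Real.pi ^ 3 / 3) *
        ∑ u, ∑ v, φ u v * (Real.log ‖siegelConst u‖ : ℂ) * (bernFract 3 (v 0) : ℂ) := by
    simp only [Finset.mul_sum, ← Finset.sum_add_distrib]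
    refine Finset.sum_congr rfl fun u _ => Finset.sum_congr rfl fun v _ => ?_
    push_cast
    ring
  rw [this, h2', h1, mul_zero, mul_zero, add_zero]

theorem imSum_isBigO (hφ : ∀ v, φ 0 v = 0) (h1 : Cond1 φ) (h2 : Cond2 φ) :
    imSum φ =O[atTop] fun y : ℝ => y * Real.exp (-(2 * Real.pi / N) * y) := by
  have key := isBigO_sum_mul (g := fun y : ℝ => y * Real.exp (-(2 * Real.pi / N) * y)) hφ
    (F := fun u v y => Real.log ‖siegelUnit u (I * y)‖ * (eisSeries 3 0 v (I * y)).im -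
      (-Real.pi * bernFract 2 (u 0) * y + Real.log ‖siegelConst u‖) *
        (4 * Real.pi ^ 3 / 3 * bernFract 3 (v 0))) fun u v hu => by
    -- `AB - A₀B₀ = A(B - B₀) + (A - A₀)B₀`, with `A₀`, `B₀` the main terms.
    have a1 := (log_norm_siegelUnit_isBigO_id hu).mul (im_eisSeries_isBigO v)
    have a2 := ((log_norm_siegelUnit_isBigO hu).mul
      (isLittleO_const_id_atTop (4 * Real.pi ^ 3 / 3 * bernFract 3 (v 0))).isBigO).congr_right
      (g₂ := fun y : ℝ => y * Real.exp (-(2 * Real.pi / N) * y)) fun y => mul_comm _ _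
    refine (a1.add a2).congr_left fun y => ?_
    ring
  refine key.congr_left fun y => ?_
  have := sum_leading_term_eq_zero h1 h2 y
  rw [← sub_zero (imSum φ y), ← this, imSum]
  simp only [← Finset.sum_sub_distrib, ← mul_sub, ofReal_sub]

/-- The action of `σ` on row vectors, as a bijection. -/
def rotEquiv (N : ℕ) : (Fin 2 → ZMod N) ≃ (Fin 2 → ZMod N) where
  toFun := rot
  invFun u := ![-u 1, u 0]
  left_inv u := by ext i; fin_cases i <;> simp [rot]
  right_inv u := by ext i; fin_cases i <;> simp [rot]

/-! ### Behaviour of `η¹` at the cusp `0`, with `rot u = uσ`. -/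

omit [NeZero N] in
theorem slash_sigma_rot (u v : Fin 2 → ZMod N) : slash φ (sigma N) (rot u) (rot v) = φ u v := by
  have h : ∀ u : Fin 2 → ZMod N,
      Matrix.vecMul (rot u) ((sigma N)⁻¹ : GL (Fin 2) (ZMod N)).val = u := fun u => by
    have : ((sigma N)⁻¹ : GL (Fin 2) (ZMod N)).val = !![0, 1; -1, 0] := rfl
    rw [this]
    ext i; fin_cases i <;> simp [rot, Matrix.vecMul, dotProduct, Fin.sum_univ_two]
  rw [slash, h, h]

omit [NeZero N] in
theorem slash_zero (hφ : ∀ v, φ 0 v = 0) (g : GL (Fin 2) (ZMod N)) (v : Fin 2 → ZMod N) :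
    slash φ g 0 v = 0 := by
  rw [slash, Matrix.zero_vecMul, hφ]

theorem sum_rot (F : (Fin 2 → ZMod N) → (Fin 2 → ZMod N) → ℂ) :
    ∑ u, ∑ v, F (rot u) (rot v) = ∑ u, ∑ v, F u v := by
  rw [← (rotEquiv N).sum_comp fun u => ∑ v, F u v]
  exact Finset.sum_congr rfl fun u _ => (rotEquiv N).sum_comp fun v => F (rot u) v

/-- The factor `-i y³` turns the imaginary part into a real part, so along `X{0,∞}` the cusp `0`
needs no condition on `φ|σ`. -/
theorem imSum_inv {y : ℝ} (hy : 0 < y) :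
    imSum φ y⁻¹ = -y ^ 3 * reSum (slash φ (sigma N)) y := by
  rw [reSum, ← sum_rot, imSum]
  simp only [Finset.mul_sum]
  refine Finset.sum_congr rfl fun u _ => Finset.sum_congr rfl fun v _ => ?_
  have : (-I * y ^ 3 * eisSeries 3 0 (rot v) (I * y)).im =
      -(y ^ 3 * (eisSeries 3 0 (rot v) (I * y)).re) := by
    rw [← ofReal_pow, mul_assoc, neg_mul, neg_im, I_mul_im, re_ofReal_mul]
  rw [log_norm_siegelUnit_inv u hy, eisSeries_inv v hy, slash_sigma_rot, this]
  push_cast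
  ring

/-- Here the imaginary part appears, and with it the main terms; this is why (C1) and (C2) are
imposed on `φ|σ` along `Y{0,∞}`. -/
theorem reSum_inv {y : ℝ} (hy : 0 < y) :
    reSum φ y⁻¹ = y ^ 3 * imSum (slash φ (sigma N)) y := by
  rw [imSum, ← sum_rot, reSum]
  simp only [Finset.mul_sum]
  refine Finset.sum_congr rfl fun u _ => Finset.sum_congr rfl fun v _ => ?_
  have : (-I * y ^ 3 * eisSeries 3 0 (rot v) (I * y)).re =
      y ^ 3 * (eisSeries 3 0 (rot v) (I * y)).im := by
    rw [← ofReal_pow, mul_assoc, neg_mul, neg_re, I_mul_re, im_ofReal_mul, neg_neg]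
  rw [log_norm_siegelUnit_inv u hy, eisSeries_inv v hy, slash_sigma_rot, this]
  push_cast
  ring

theorem convergesAbsolutely_eta1Lin_one_zero (hφ : ∀ v, φ 0 v = 0) (h1 : Cond1 φ) (h2 : Cond2 φ) :
    ConvergesAbsolutely 1 0 (eta1Lin φ) := by
  set b := 2 * Real.pi / N with hb
  have hbpos : 0 < b := two_pi_div_pos
  have hid : (fun y : ℝ => (y : ℂ)) =O[atTop] fun y : ℝ => y :=
    IsBigO.of_norm_left (by simpa using (isBigO_refl (fun y : ℝ => y) atTop).norm_left)
  refine convergesAbsolutely_of_integrableOn (f := fun y : ℝ => 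
      ((-(6 / (Real.pi * N ^ 2)) : ℝ) : ℂ) * (y * imSum φ y))
    (fun p _ => shokurovDensity_eta1Lin_one_zero p)
    (integrableOn_Ioi_zero_of_isBigO (half_pos hbpos) ?_ ?_ ?_)
  · exact continuousOn_const.mul (continuous_ofReal.continuousOn.mul (continuousOn_imSum hφ))
  · refine IsBigO.const_mul_left (((hid.mul (imSum_isBigO hφ h1 h2)).congr_right fun y => ?_).trans
      (pow_mul_exp_isBigO 2 hbpos)) _
    ring
  · refine IsBigO.const_mul_left ?_ _
    -- The factor `y` of the density becomes `y⁻¹`, which lowers the `y³` of `imSum_inv` to `y²`.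
    have h := ((hid.pow 2).mul (reSum_isBigO (slash_zero hφ (sigma N)))).congr_right
      (g₂ := fun y : ℝ => y ^ 3 * Real.exp (-b * y)) fun y => by ring
    refine IsBigO.trans (IsBigO.of_bound 1 ?_) ((h.trans (pow_mul_exp_isBigO 3 hbpos)).trans
      (exp_neg_isBigO_one (half_pos hbpos)))
    filter_upwards [eventually_gt_atTop 0] with y hy
    have hyc : (y : ℂ) ≠ 0 := by exact_mod_cast hy.ne'
    rw [imSum_inv hy, one_mul]
    refine le_of_eq ?_
    rw [← norm_neg]
    congr 1
    push_cast
    field_simp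

theorem convergesAbsolutely_eta1Lin_zero_one (hφ : ∀ v, φ 0 v = 0)
    (h1 : Cond1 (slash φ (sigma N))) (h2 : Cond2 (slash φ (sigma N))) :
    ConvergesAbsolutely 0 1 (eta1Lin φ) := by
  set b := 2 * Real.pi / N with hb
  have hbpos : 0 < b := two_pi_div_pos
  have hid : (fun y : ℝ => (y : ℂ)) =O[atTop] fun y : ℝ => y :=
    IsBigO.of_norm_left (by simpa using (isBigO_refl (fun y : ℝ => y) atTop).norm_left)
  refine convergesAbsolutely_of_integrableOn (f := fun y : ℝ => 
      ((6 / (Real.pi * N ^ 2) : ℝ) : ℂ) * reSum φ y)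
    (fun p _ => shokurovDensity_eta1Lin_zero_one p)
    (integrableOn_Ioi_zero_of_isBigO (half_pos hbpos) ?_ ?_ ?_)
  · exact continuousOn_const.mul (continuousOn_reSum hφ)
  · refine IsBigO.const_mul_left (((reSum_isBigO hφ).congr_right fun y => ?_).trans
      (pow_mul_exp_isBigO 1 hbpos)) _
    ring
  · refine IsBigO.const_mul_left ?_ _
    have h := ((hid.pow 3).mul (imSum_isBigO (slash_zero hφ (sigma N)) h1 h2)).congr_right
      (g₂ := fun y : ℝ => y ^ 4 * Real.exp (-b * y)) fun y => by ring
    refine IsBigO.trans (IsBigO.of_bound 1 ?_) ((h.trans (pow_mul_exp_isBigO 4 hbpos)).trans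
      (exp_neg_isBigO_one (half_pos hbpos)))
    filter_upwards [eventually_gt_atTop 0] with y hy
    rw [reSum_inv hy, one_mul]

end

end EisensteinSymbol

theorem mainTheorem2 (N : ℕ) [NeZero N] (hN : 3 ≤ N) :
    (∀ u v : Fin 2 → ZMod N, u ≠ 0 → ∀ m n : ℤ,
      EisensteinSymbol.ConvergesAbsolutely m n (EisensteinSymbol.eta2 u v)) ∧
    (∀ φ : (Fin 2 → ZMod N) → (Fin 2 → ZMod N) → ℂ, (∀ v, φ 0 v = 0) →
      EisensteinSymbol.Cond1 φ → EisensteinSymbol.Cond2 φ →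
      EisensteinSymbol.ConvergesAbsolutely 1 0 (EisensteinSymbol.eta1Lin φ)) ∧
    (∀ φ : (Fin 2 → ZMod N) → (Fin 2 → ZMod N) → ℂ, (∀ v, φ 0 v = 0) →
      EisensteinSymbol.Cond1 (EisensteinSymbol.slash φ (EisensteinSymbol.sigma N)) →
      EisensteinSymbol.Cond2 (EisensteinSymbol.slash φ (EisensteinSymbol.sigma N)) →
      EisensteinSymbol.ConvergesAbsolutely 0 1 (EisensteinSymbol.eta1Lin φ)) :=
  ⟨fun _ v hu m n => EisensteinSymbol.convergesAbsolutely_eta2 hu v m n,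
    fun _ hφ h1 h2 => EisensteinSymbol.convergesAbsolutely_eta1Lin_one_zero hφ h1 h2,
    fun _ hφ h1 h2 => EisensteinSymbol.convergesAbsolutely_eta1Lin_zero_one hφ h1 h2⟩
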